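/- **Setting.** Let $\Gamma$ be a group acting isometrically on the Euclidean space $\mathbb R^m$ with a relatively compact fundamental domain $F$ containing the origin in its interior (i.e. $\overline F$ is compact, the translates of $\overline F$ cover $\mathbb R^m$, and the translates of the interior of $F$ by distinct elements are disjoint). Let $\Lambda\le\Gamma$ be a finite index subgroup that acts by translations and is identified, via $g\mapsto g.0$, with a lattice in $\mathbb R^m$ (so $\Lambda$ is free abelian of rank $m$). Put $\Phi(x)=x.0\in\mathbb R^m$ for $x\in\Gamma$. Let $\mu$ be a symmetric probability measure on $\Gamma$ with finite support $S$ such that $S$ generates $\Gamma$ as a semigroup and $\mu(\mathrm{id})>0$, and let $\mu_n$ be its $n$-fold convolution power. Let $G=\Lambda\backslash\mathrm{Cay}(\Gamma,S)$ be the finite multigraph with vertex set $V=\Lambda\backslash\Gamma$ and oriented edges $e=(x,s)\in V\times S$ from $oe=x$ to $te=x.s$, with reversed edge $\bar e=(x.s,s^{-1})$ and conductance $c(e)=\mu(s)/|V|$. A $1$-form is a function $\omega$ on the oriented edges with $\omega(\bar e)=-\omega(e)$; it is harmonic if $\sum_{oe=x}c(e)\omega(e)=0$ for every $x\in V$. Every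 $1$-form $\omega$ has a unique harmonic part, the harmonic $u$ for which $\omega(e)-u(e)=f(te)-f(oe)$ for some $f:V\to\mathbb R$. For $v\in\mathbb R^m$ let $\hat v(e)=\langle v,\Phi_e\rangle$, where $\Phi_e=\Phi(ys)-\Phi(y)$ for $e=(\Lambda y,s)$. For a positive definite $m\times m$ matrix $M$ put $$\xi_M(x)=\frac{1}{(2\pi)^{m/2}\sqrt{\det M}}\,e^{-\frac12\langle\Phi(x),M^{-1}\Phi(x)\rangle},\qquad \mathcal N^\Phi_M(x)=\frac{\xi_M(x)}{\sum_{y\in\Gamma}\xi_M(y)}\qquad(x\in\Gamma).$$ **Theorem.** There is a positive definite matrix $\Sigma$, determined by $$\langle v_1,\Sigma v_2\rangle=\sum_{e}u_1(e)u_2(e)c(e)\qquad(v_1,v_2\in\mathbb R^m),$$ where the sum is over all oriented edges of $G$ and $u_i$ is the harmonic part of $\hat v_i$, such that $\mathcal N^\Phi_{n\Sigma}$ is a well-defined probability distribution on $\Gamma$ for every $n\ge1$, and there is a constant $C>0$ such that for all integers $n>1$ $$\|\mu_n-\mathcal N^\Phi_{n\Sigma}\|_{\mathrm{TV}}\le\frac{C(\log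 n)^{m/2}}{\sqrt n},$$ where $\|\nu_1-\nu_2\|_{\mathrm{TV}}=\frac12\sum_{x\in\Gamma}|\nu_1(x)-\nu_2(x)|$. -/

import Mathlib

namespace LatticeWalk

noncomputable section

/-- `F` is a relatively compact fundamental domain for the isometric action `ρ` of `Γ` on `ℝᵐ`, in
the usual topological sense: its closure is compact, the translates of its closure cover `ℝᵐ`, and
the translates of its interior by distinct group elements are disjoint. -/
structure IsFundamentalDomain {Γ : Type*} [Group Γ] {m : ℕ}
    (ρ : Γ →* (EuclideanSpace ℝ (Fin m) ≃ᵢ EuclideanSpace ℝ (Fin m)))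
    (F : Set (EuclideanSpace ℝ (Fin m))) : Prop where
  isCompact_closure : IsCompact (closure F)
  iUnion_closure : ⋃ g : Γ, ρ g '' closure F = Set.univ
  disjoint_interior : ∀ g h : Γ, g ≠ h → Disjoint (ρ g '' interior F) (ρ h '' interior F)

/-- An isometric action `ρ` of `Γ` on the Euclidean space `ℝᵐ` having a relatively compact
fundamental domain with the origin in its interior, with a finite index subgroup `Λ` that acts by
translations and is identified, through `g ↦ g • 0`, with a lattice in `ℝᵐ`.
(The identification is injective because the origin is interior to a fundamental domain.
In particular `Λ` is free abelian of rank `m`.) -/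
structure LatticeAction (Γ : Type*) [Group Γ] (m : ℕ) where
  ρ : Γ →* (EuclideanSpace ℝ (Fin m) ≃ᵢ EuclideanSpace ℝ (Fin m))
  Λ : Subgroup Γ
  finiteIndex : Λ.FiniteIndex
  translation : ∀ g ∈ Λ, ∀ v, ρ g v = ρ g 0 + v
  lattice : ∃ b : Module.Basis (Fin m) ℝ (EuclideanSpace ℝ (Fin m)),
    (fun g : Γ => ρ g 0) '' (Λ : Set Γ) = (Submodule.span ℤ (Set.range b) : Set _)
  exists_fundamentalDomain : ∃ F, IsFundamentalDomain ρ F ∧ 0 ∈ interior F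

/-- A finitely supported symmetric probability measure on the group `Γ`. -/
structure SymmetricLaw (Γ : Type*) [Group Γ] where
  toPMF : PMF Γ
  finite_support : toPMF.support.Finite
  symm : ∀ s, toPMF s⁻¹ = toPMF s

/-- The `n`-fold convolution power `μ_n` of `μ`, that is, the law of `s₁ s₂ ⋯ sₙ` where the `sᵢ` are
independent with law `μ`. -/
def convPow {Γ : Type*} [Group Γ] (μ : PMF Γ) : ℕ → PMF Γ
  | 0 => PMF.pure 1
  | n + 1 => (convPow μ n).bind fun x => μ.map fun s => x * s

/-- The total variation distance, as half of the `ℓ¹`-distance. -/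
def tvDist {Γ : Type*} (p q : Γ → ℝ) : ℝ := (1 / 2) * ∑' x, |p x - q x|

namespace SymmetricLaw

variable {Γ : Type*} [Group Γ] (μ : SymmetricLaw Γ)

/-- The support of `μ`. -/
def S : Finset Γ := μ.finite_support.toFinset

/-- The mass `μ(s)` as a real number. -/
def mass (s : Γ) : ℝ := (μ.toPMF s).toReal

theorem mem_S {s : Γ} : s ∈ μ.S ↔ s ∈ μ.toPMF.support := by simp [S]

theorem inv_mem_S {s : Γ} (h : s ∈ μ.S) : s⁻¹ ∈ μ.S := by
  rw [mem_S, PMF.mem_support_iff] at *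
  rwa [μ.symm]

theorem mass_inv (s : Γ) : μ.mass s⁻¹ = μ.mass s := by simp [mass, μ.symm]

theorem mass_pos {s : Γ} (h : s ∈ μ.S) : 0 < μ.mass s := by
  rw [mem_S, PMF.mem_support_iff] at h
  exact ENNReal.toReal_pos h (μ.toPMF.apply_ne_top s)

end SymmetricLaw

namespace LatticeAction

variable {Γ : Type*} [Group Γ] {m : ℕ} (A : LatticeAction Γ m)

/-- The equivariant embedding `Φ(x) = x • 0`. -/
def Φ (x : Γ) : EuclideanSpace ℝ (Fin m) := A.ρ x 0

theorem Φ_mul_of_mem {g : Γ} (hg : g ∈ A.Λ) (x : Γ) : A.Φ (g * x) = A.Φ g + A.Φ x := by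
  simp only [Φ, map_mul]
  exact A.translation g hg _

/-- The vertex set `Λ \ Γ` of the quotient graph `G = Λ \ Cay(Γ, S)`. -/
def Vertex : Type _ := Quotient (QuotientGroup.rightRel A.Λ)

instance : Finite A.Vertex :=
  haveI := A.finiteIndex
  Finite.of_equiv _ (QuotientGroup.quotientRightRelEquivQuotientLeftRel A.Λ).symm

instance : Fintype A.Vertex := Fintype.ofFinite _

/-- The coset `Λ x`. -/
def coset (x : Γ) : A.Vertex := Quotient.mk (QuotientGroup.rightRel A.Λ) x

instance : Nonempty A.Vertex := ⟨A.coset 1⟩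

theorem coset_eq {x y : Γ} : A.coset x = A.coset y ↔ y * x⁻¹ ∈ A.Λ := by
  rw [← QuotientGroup.rightRel_apply]
  exact Quotient.eq

/-- The right action `x.s` of `s ∈ Γ` on a vertex `x ∈ Λ \ Γ`. -/
def step (x : A.Vertex) (s : Γ) : A.Vertex :=
  Quotient.lift (fun y => A.coset (y * s)) (by
    intro a b h
    have h' := QuotientGroup.rightRel_apply.1 h
    rw [A.coset_eq]
    simpa [mul_assoc] using h') x

@[simp] theorem step_coset (x s : Γ) : A.step (A.coset x) s = A.coset (x * s) := rfl

theorem step_step_inv (x : A.Vertex) (s : Γ) : A.step (A.step x s) s⁻¹ = x := by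
  induction x using Quotient.inductionOn with
  | h y =>
    change A.coset (y * s * s⁻¹) = A.coset y
    simp

theorem step_inv_step (x : A.Vertex) (s : Γ) : A.step (A.step x s⁻¹) s = x := by
  simpa using A.step_step_inv x s⁻¹

variable (μ : SymmetricLaw Γ)

/-- The oriented edges of the quotient multigraph `G`: the edge `(x, s)` goes from `x` to `x.s`. -/
abbrev Edge : Type _ := A.Vertex × μ.S

variable {A μ}

/-- The origin of an oriented edge. -/
def orig (e : A.Edge μ) : A.Vertex := e.1

/-- The terminus of an oriented edge. -/
def term (e : A.Edge μ) : A.Vertex := A.step e.1 e.2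

/-- The reversed edge. -/
def rev (e : A.Edge μ) : A.Edge μ := (term e, ⟨(e.2 : Γ)⁻¹, μ.inv_mem_S e.2.2⟩)

theorem rev_rev (e : A.Edge μ) : rev (rev e) = e := by
  obtain ⟨x, s, hs⟩ := e
  simp [rev, term, step_step_inv]

@[simp] theorem orig_rev (e : A.Edge μ) : orig (rev e) = term e := rfl

@[simp] theorem term_rev (e : A.Edge μ) : term (rev e) = orig e := A.step_step_inv _ _

/-- Edge reversal as a permutation of the edges. -/
def revEquiv : A.Edge μ ≃ A.Edge μ := ⟨rev, rev, rev_rev, rev_rev⟩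

variable (A μ)

/-- The uniform distribution on the vertices. -/
def unif : ℝ := 1 / (Fintype.card A.Vertex : ℝ)

theorem unif_pos : 0 < A.unif := by
  unfold unif
  have : 0 < Fintype.card A.Vertex := Fintype.card_pos
  positivity

variable {A μ}

/-- The conductance `c(e) = π(oe) p(e)`, where `p((x, x.s)) = μ(s)`. -/
def cond (e : A.Edge μ) : ℝ := A.unif * μ.mass e.2

theorem cond_pos (e : A.Edge μ) : 0 < cond e := mul_pos A.unif_pos (μ.mass_pos e.2.2)

theorem cond_rev (e : A.Edge μ) : cond (rev e) = cond e := by simp [cond, rev, μ.mass_inv]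

variable (A μ)

/-- The space `C¹(G, ℝ)` of real `1`-forms. -/
def OneForm : Submodule ℝ (A.Edge μ → ℝ) where
  carrier := {ω | ∀ e, ω (rev e) = -ω e}
  zero_mem' := by simp
  add_mem' := by
    intro a b ha hb e
    simp only [Set.mem_ofPred_eq, Pi.add_apply] at *
    rw [ha e, hb e]; ring
  smul_mem' := by
    intro r a ha e
    simp only [Set.mem_ofPred_eq, Pi.smul_apply, smul_eq_mul] at *
    rw [ha e]; ring

/-- The differential `df(e) = f(te) - f(oe)`. -/
def d : (A.Vertex → ℝ) →ₗ[ℝ] A.OneForm μ where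
  toFun f := ⟨fun e => f (term e) - f (orig e), fun e => by simp⟩
  map_add' f g := by ext e; simp; ring
  map_smul' r f := by ext e; simp; ring

open Classical in
/-- The codifferential `d*ω(x) = -∑_{oe = x} c(e) ω(e) / π(x)`. -/
def dStar : A.OneForm μ →ₗ[ℝ] (A.Vertex → ℝ) where
  toFun ω x := -∑ e : A.Edge μ with orig e = x, 1 / A.unif * cond e * (ω : A.Edge μ → ℝ) e
  map_add' ω η := by
    ext x
    simp only [Submodule.coe_add, Pi.add_apply, mul_add, Finset.sum_add_distrib]
    ring
  map_smul' r ω := by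
    ext x
    simp only [Submodule.coe_smul, Pi.smul_apply, smul_eq_mul, RingHom.id_apply, mul_neg,
      Finset.mul_sum]
    congr 1
    exact Finset.sum_congr rfl fun e _ => by ring

/-- The space `H¹` of harmonic `1`-forms. -/
def Harmonic : Submodule ℝ (A.OneForm μ) := LinearMap.ker (A.dStar μ)

/-- The inner product `⟨ω, η⟩_c = (1/2) ∑_e ω(e) η(e) c(e)` on `1`-forms. -/
def form : LinearMap.BilinForm ℝ (A.OneForm μ) :=
  LinearMap.mk₂ ℝ
    (fun ω η => (1 / 2) * ∑ e, (ω : A.Edge μ → ℝ) e * (η : A.Edge μ → ℝ) e * cond e)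
    (by
      intro a b c
      rw [← mul_add, ← Finset.sum_add_distrib]
      congr 1
      exact Finset.sum_congr rfl fun e _ => by simp only [Submodule.coe_add, Pi.add_apply]; ring)
    (by
      intro r a c
      rw [smul_eq_mul, mul_left_comm]
      simp only [Finset.mul_sum]
      exact Finset.sum_congr rfl fun e _ => by
        simp only [Submodule.coe_smul, Pi.smul_apply, smul_eq_mul]; ring)
    (by
      intro a b c
      rw [← mul_add, ← Finset.sum_add_distrib]
      congr 1
      exact Finset.sum_congr rfl fun e _ => by simp only [Submodule.coe_add, Pi.add_apply]; ring)
    (by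
      intro r a c
      rw [smul_eq_mul, mul_left_comm]
      simp only [Finset.mul_sum]
      exact Finset.sum_congr rfl fun e _ => by
        simp only [Submodule.coe_smul, Pi.smul_apply, smul_eq_mul]; ring)

theorem form_apply (ω η : A.OneForm μ) :
    A.form μ ω η = (1 / 2) * ∑ e, (ω : A.Edge μ → ℝ) e * (η : A.Edge μ → ℝ) e * cond e := rfl

/-- `d*` is the adjoint of `d`. -/
theorem form_d (f : A.Vertex → ℝ) (ω : A.OneForm μ) :
    A.form μ (A.d μ f) ω = ∑ x, f x * A.dStar μ ω x * A.unif := by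
  classical
  have h1 : ∑ e : A.Edge μ, f (term e) * (ω : A.Edge μ → ℝ) e * cond e
      = -∑ e : A.Edge μ, f (orig e) * (ω : A.Edge μ → ℝ) e * cond e := by
    rw [← Equiv.sum_comp revEquiv, ← Finset.sum_neg_distrib]
    refine Finset.sum_congr rfl fun e _ => ?_
    change f (term (rev e)) * (ω : A.Edge μ → ℝ) (rev e) * cond (rev e) = _
    rw [term_rev, cond_rev, ω.2 e]
    ring
  have h2 : A.form μ (A.d μ f) ω = -∑ e : A.Edge μ, f (orig e) * (ω : A.Edge μ → ℝ) e * cond e := by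
    have : A.form μ (A.d μ f) ω = (1 / 2) * (∑ e : A.Edge μ, f (term e) * (ω : A.Edge μ → ℝ) e * cond e
        - ∑ e : A.Edge μ, f (orig e) * (ω : A.Edge μ → ℝ) e * cond e) := by
      rw [form_apply, ← Finset.sum_sub_distrib]
      congr 1
      refine Finset.sum_congr rfl fun e _ => ?_
      change (f (term e) - f (orig e)) * _ * _ = _
      ring
    rw [this, h1]; ring
  rw [h2, ← Finset.sum_fiberwise Finset.univ orig, ← Finset.sum_neg_distrib]
  refine Finset.sum_congr rfl fun x _ => ?_
  change _ = f x * (-∑ e : A.Edge μ with orig e = x, 1 / A.unif * cond e * (ω : A.Edge μ → ℝ) e) * _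
  rw [mul_neg, neg_mul, Finset.mul_sum, Finset.sum_mul]
  congr 1
  refine Finset.sum_congr rfl fun e he => ?_
  rw [(Finset.mem_filter.1 he).2]
  field_simp [A.unif_pos.ne']

theorem form_isSymm : (A.form μ).IsSymm :=
  ⟨fun ω η => by
    simp only [form_apply]
    congr 1
    exact Finset.sum_congr rfl fun e _ => by ring⟩

theorem eq_zero_of_form_self (ω : A.OneForm μ) (h : A.form μ ω ω = 0) : ω = 0 := by
  rw [form_apply] at h
  have h' : ∑ e, (ω : A.Edge μ → ℝ) e * (ω : A.Edge μ → ℝ) e * cond e = 0 := by linarith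
  rw [Finset.sum_eq_zero_iff_of_nonneg
    (fun e _ => mul_nonneg (mul_self_nonneg _) (cond_pos e).le)] at h'
  ext e
  have := h' e (Finset.mem_univ e)
  simpa [(cond_pos e).ne'] using this

theorem orthogonal_range_d :
    (A.form μ).orthogonal (LinearMap.range (A.d μ)) = A.Harmonic μ := by
  classical
  ext ω
  rw [LinearMap.BilinForm.mem_orthogonal_iff, Harmonic, LinearMap.mem_ker]
  constructor
  · intro h
    ext x
    have := h _ ⟨Pi.single x 1, rfl⟩
    rw [form_d] at this
    simpa [Pi.single_apply, A.unif_pos.ne'] using this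
  · rintro h _ ⟨f, rfl⟩
    rw [form_d, h]
    simp

/-- The decomposition `C¹ = H¹ ⊕ Im d`. -/
theorem isCompl_harmonic : IsCompl (A.Harmonic μ) (LinearMap.range (A.d μ)) := by
  rw [← orthogonal_range_d]
  refine (LinearMap.BilinForm.isCompl_orthogonal_of_restrict_nondegenerate
    (A.form_isSymm μ).isRefl ?_).symm
  refine LinearMap.BilinForm.nondegenerate_restrict_of_disjoint_orthogonal _
    (A.form_isSymm μ).isRefl ?_
  rw [Submodule.disjoint_def]
  intro ω h1 h2
  exact A.eq_zero_of_form_self μ ω (h2 ω h1)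

/-- The harmonic part of a `1`-form `ω`: the unique `u ∈ H¹` with `u + df = ω` for some `f`. -/
def harmonicPart : A.OneForm μ →ₗ[ℝ] A.Harmonic μ :=
  Submodule.projectionOnto _ _ (A.isCompl_harmonic μ)

/-- The characterization of the harmonic part. -/
theorem harmonicPart_eq_iff (ω : A.OneForm μ) (u : A.Harmonic μ) :
    A.harmonicPart μ ω = u ↔ ∃ f, (u : A.OneForm μ) + A.d μ f = ω := by
  constructor
  · rintro rfl
    have h : ω - (A.harmonicPart μ ω : A.OneForm μ) ∈ LinearMap.range (A.d μ) := by
      rw [← Submodule.projectionOnto_apply_eq_zero_iff (A.isCompl_harmonic μ), map_sub]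
      rw [Submodule.projectionOnto_apply_left]
      exact sub_self _
    obtain ⟨f, hf⟩ := h
    exact ⟨f, by rw [hf]; abel⟩
  · rintro ⟨f, rfl⟩
    unfold harmonicPart
    rw [map_add, Submodule.projectionOnto_apply_left,
      (Submodule.projectionOnto_apply_eq_zero_iff (A.isCompl_harmonic μ)).2 ⟨f, rfl⟩, add_zero]

/-- The vector `Φ_e`: for the edge `e = (Λx, s)` it is `Φ(xs) - Φ(x)`. -/
def ΦEdge {A : LatticeAction Γ m} {μ : SymmetricLaw Γ} (e : A.Edge μ) :
    EuclideanSpace ℝ (Fin m) :=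
  Quotient.lift (s := QuotientGroup.rightRel A.Λ) (fun x : Γ => A.Φ (x * e.2) - A.Φ x) (by
    intro a b h
    have h' := QuotientGroup.rightRel_apply.1 h
    have hb : A.Φ b = A.Φ (b * a⁻¹) + A.Φ a := by
      rw [← A.Φ_mul_of_mem h', inv_mul_cancel_right]
    have hbs : b * (e.2 : Γ) = b * a⁻¹ * (a * e.2) := by group
    change A.Φ (a * e.2) - A.Φ a = A.Φ (b * e.2) - A.Φ b
    rw [hbs, A.Φ_mul_of_mem h', hb]
    abel) e.1

theorem ΦEdge_mk (x : Γ) (s : μ.S) :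
    ΦEdge ((A.coset x, s) : A.Edge μ) = A.Φ (x * s) - A.Φ x := rfl

theorem ΦEdge_rev (e : A.Edge μ) : ΦEdge (rev e) = -ΦEdge e := by
  obtain ⟨x, s⟩ := e
  induction x using Quotient.inductionOn with
  | h y =>
    change A.Φ (y * s * (s : Γ)⁻¹) - A.Φ (y * s) = -(A.Φ (y * s) - A.Φ y)
    simp

/-- The `1`-form `e ↦ ⟨v, Φ_e⟩` attached to `v ∈ ℝᵐ`. -/
def hat (v : EuclideanSpace ℝ (Fin m)) : A.OneForm μ :=
  ⟨fun e => inner ℝ v (ΦEdge e), fun e => by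
    simp only [ΦEdge_rev, inner_neg_right]⟩

/-- The matrix `M` satisfies `⟨v₁, M v₂⟩ = ∑_{e ∈ E(G)} u₁(e) u₂(e) c(e)` for all `v₁, v₂ ∈ ℝᵐ`,
where `uᵢ` is the harmonic part of the `1`-form `e ↦ ⟨vᵢ, Φ_e⟩`; this determines `M`. -/
def IsCovariance (M : Matrix (Fin m) (Fin m) ℝ) : Prop :=
  ∀ v₁ v₂ : EuclideanSpace ℝ (Fin m),
    inner ℝ v₁ (WithLp.toLp 2 (M.mulVec v₂.ofLp)) =
      ∑ e : A.Edge μ,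
        ((A.harmonicPart μ (A.hat μ v₁) : A.OneForm μ) : A.Edge μ → ℝ) e *
          ((A.harmonicPart μ (A.hat μ v₂) : A.OneForm μ) : A.Edge μ → ℝ) e * cond e

/-- The Gaussian density `ξ_M` with covariance matrix `M`, evaluated along the embedding `Φ`. -/
def ξ (M : Matrix (Fin m) (Fin m) ℝ) (x : Γ) : ℝ :=
  1 / ((2 * Real.pi) ^ ((m : ℝ) / 2) * √M.det) *
    Real.exp (-(1 / 2) * inner ℝ (A.Φ x) (WithLp.toLp 2 (M⁻¹.mulVec (A.Φ x).ofLp)))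

/-- The discrete normal distribution `N^Φ_M` on `Γ`: the normalization of `ξ_M`. -/
def discreteNormal (M : Matrix (Fin m) (Fin m) ℝ) (x : Γ) : ℝ :=
  A.ξ M x / ∑' y, A.ξ M y

end LatticeAction

end

end LatticeWalk

namespace LatticeWalk

noncomputable section

open MeasureTheory Complex

/-! Correct $\Phi$ by a bounded function on $V$ to a map $\Psi$, still $\Lambda$-equivariant, whose
increments have mean zero at every vertex (`exists_harmonicMap`). The increments of $\langle
v,\Psi\rangle$ form the harmonic part of $\hat v$, so $\Sigma$ is their covariance under the uniform
law on $V$. It is definite because a direction without variance would make $\langle v,\Psi\rangle$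
constant on $\Gamma$.

By Fourier inversion $\mu_n(x)$ is, up to a constant, the integral over a cell of the dual lattice
of $e^{-i\langle\theta,\Psi(x)-\Psi(1)\rangle}(T_\theta^n\delta_{\Lambda x})(\Lambda)$, where
$T_\theta$ is the transition operator on functions on $V$ twisted by $\theta$. Two facts control
$T_\theta^n$. Since $\mu(1)>0$ and $S$ generates, a Poincaré inequality gives $\|T_\theta\|\le
e^{-c|\theta|^2}$ on the whole cell (`exists_norm_twist_le`). And the constant function is nearly an
eigenvector with eigenvalue $e^{-q(\theta)/2}$, $q(\theta)=\langle\theta,\Sigma\theta\rangle$: the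
defect is a mean-zero part of size $|\theta|^2$, which $T_0$ contracts geometrically, plus a
remainder of size $|\theta|^3$. Telescoping replaces eigenvalue perturbation theory and gives
$T_\theta^n\delta_v=|V|^{-1}e^{-nq/2}+O(n^{-1/2}e^{-cn|\theta|^2})$. Integrating yields a local
limit theorem with error $O(n^{-1/2-m/2})$ uniform in $x$ (`exists_law_sub_le`); passing from
$\Psi(x)-\Psi(1)$ to $\Phi(x)$ costs no more.

For total variation, sum this error over a ball of radius of order $\sqrt{n\log n}$, which holds
$O((n\log n)^{m/2})$ orbit points; this is the source of the logarithm. Outside the ball the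
Gaussian tail is explicit and the walk has a Chernoff bound, both $O(n^{-1/2})$. The comparison is
with a multiple $\kappa\,\xi$ whose constant is never identified: as $\mu_n$ has mass one, $\kappa$
must be close to the normalizing factor. -/

/-! ### Elementary estimates and integrals -/

theorem exp_le_add_exp_sq (x : ℝ) : Real.exp x ≤ x + Real.exp (x ^ 2) := by
  have h2 := Real.add_one_le_exp (x ^ 2)
  rcases le_total 1 |x| with h | h
  · rcases le_total 0 x with hx | hx
    · rw [abs_of_nonneg hx] at h
      have : Real.exp x ≤ Real.exp (x ^ 2) := Real.exp_le_exp.2 (by nlinarith)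
      linarith
    · rw [abs_of_nonpos hx] at h
      have : Real.exp x ≤ 1 := Real.exp_le_one_iff.2 hx
      nlinarith
  · have := (abs_le.1 (Real.abs_exp_sub_one_sub_id_le h)).2
    linarith

theorem exists_pow_mul_exp_neg_le (k : ℕ) {a : ℝ} (ha : 0 < a) :
    ∃ C : ℝ, 0 < C ∧ ∀ u : ℝ, 0 ≤ u → u ^ k * Real.exp (-(a * u ^ 2)) ≤ C := by
  -- From $u^k\le k!\,e^u$ and $\max_u(u-au^2)=1/(4a)$.
  refine ⟨k.factorial * Real.exp (1 / (4 * a)), by positivity, fun u hu => ?_⟩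
  have h1 : u ^ k ≤ k.factorial * Real.exp u := by
    have := Real.pow_div_factorial_le_exp u hu k
    rw [div_le_iff₀ (by positivity)] at this
    linarith
  calc u ^ k * Real.exp (-(a * u ^ 2))
      ≤ k.factorial * Real.exp u * Real.exp (-(a * u ^ 2)) := by gcongr
    _ = k.factorial * Real.exp (u - a * u ^ 2) := by rw [mul_assoc, ← Real.exp_add, sub_eq_add_neg]
    _ ≤ _ := by
      gcongr
      rw [← sub_nonneg]
      have : 1 / (4 * a) - (u - a * u ^ 2) = a * (u - 1 / (2 * a)) ^ 2 := by field_simp; ring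
      rw [this]; positivity

theorem exists_pow_le_div_sqrt {ρ : ℝ} (h0 : 0 ≤ ρ) (h1 : ρ < 1) :
    ∃ C : ℝ, 0 < C ∧ ∀ n : ℕ, 1 ≤ n → ρ ^ n ≤ C / √n := by
  have h := tendsto_pow_const_mul_const_pow_of_abs_lt_one 1 (r := ρ) (by rwa [abs_of_nonneg h0])
  obtain ⟨C, hC⟩ := h.bddAbove_range
  refine ⟨max C 1, by positivity, fun n hn => ?_⟩
  have hn' : (1 : ℝ) ≤ n := by exact_mod_cast hn
  rw [le_div_iff₀ (by positivity)]
  have h3 : √(n : ℝ) ≤ n := by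
    rw [Real.sqrt_le_left (by positivity)]; nlinarith
  have h2 : (n : ℝ) ^ 1 * ρ ^ n ≤ C := hC ⟨n, rfl⟩
  calc ρ ^ n * √n ≤ ρ ^ n * n := by gcongr
    _ ≤ C := by linarith
    _ ≤ _ := le_max_left _ _

/-- The derivative $-xe^{-x^2/2}$ is bounded by one. This makes a bounded displacement of the
argument of a Gaussian of width $\sqrt n$ cost only $O(n^{-1/2})$. -/
theorem abs_exp_neg_sq_sub_le (u v : ℝ) :
    |Real.exp (-(u ^ 2 / 2)) - Real.exp (-(v ^ 2 / 2))| ≤ |u - v| := by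
  have hd : ∀ x : ℝ, HasDerivAt (fun x : ℝ => Real.exp (-(x ^ 2 / 2)))
      (Real.exp (-(x ^ 2 / 2)) * (-x)) x := fun x => by
    have h := (((hasDerivAt_pow 2 x).div_const 2).neg).exp
    have e : Real.exp (-(x ^ 2 / 2)) * -x =
        Real.exp ((-fun x : ℝ => x ^ 2 / 2) x) * -(((2 : ℕ) : ℝ) * x ^ (2 - 1) / 2) := by
      simp
    rw [e]
    exact h
  have := Convex.norm_image_sub_le_of_norm_hasDerivWithin_le (𝕜 := ℝ) (C := 1) (s := Set.univ)
    (fun x _ => (hd x).hasDerivWithinAt) (fun x _ => ?_) convex_univ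
    (Set.mem_univ v) (Set.mem_univ u)
  · simpa using this
  · rw [norm_mul, norm_neg, Real.norm_eq_abs, Real.abs_exp, Real.norm_eq_abs, Real.exp_neg,
      inv_mul_le_iff₀ (Real.exp_pos _)]
    have := Real.add_one_le_exp (x ^ 2 / 2)
    rw [← sq_abs] at this ⊢
    nlinarith [sq_nonneg (|x| - 1)]

/-- Haar measure is unique up to a scalar. The value of the scalar is irrelevant, since all such
constants end up in the unidentified factor $\kappa$. -/
theorem exists_integral_comp_equiv {E F : Type*} [NormedAddCommGroup E] [NormedSpace ℝ E]
    [MeasurableSpace E] [BorelSpace E] [FiniteDimensional ℝ E]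
    [NormedAddCommGroup F] [NormedSpace ℝ F] [MeasurableSpace F] [BorelSpace F]
    [FiniteDimensional ℝ F] (μ : Measure E) [μ.IsAddHaarMeasure] (ν : Measure F)
    [ν.IsAddHaarMeasure] (e : E ≃L[ℝ] F) :
    ∃ c : ℝ, 0 < c ∧ ∀ f : F → ℂ, ∫ x, f (e x) ∂μ = c * ∫ y, f y ∂ν := by
  have : (μ.map e).IsAddHaarMeasure := e.isAddHaarMeasure_map μ
  have h := Measure.isAddLeftInvariant_eq_smul (μ.map e) ν
  refine ⟨(Measure.addHaarScalarFactor (μ.map e) ν : ℝ),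
    NNReal.coe_pos.2 (Measure.addHaarScalarFactor_pos_of_isAddHaarMeasure _ _), fun f => ?_⟩
  refine (e.toHomeomorph.measurableEmbedding.integral_map (μ := μ) f).symm.trans ?_
  change ∫ y, f y ∂(μ.map e) = _
  conv_lhs => rw [h]
  rw [integral_smul_nnreal_measure, NNReal.smul_def, Complex.real_smul]

theorem integral_Icc_cexp_int (k : ℤ) :
    ∫ t : ℝ, (Set.Icc (-Real.pi) Real.pi).indicator (fun t : ℝ => cexp (I * (t * k))) t =
      if k = 0 then ((2 * Real.pi : ℝ) : ℂ) else 0 := by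
  have hpi := Real.pi_pos
  rw [integral_indicator measurableSet_Icc, integral_Icc_eq_integral_Ioc,
    ← intervalIntegral.integral_of_le (by linarith)]
  split_ifs with hk
  · subst hk
    simp
    ring
  · have hk' : (I * k : ℂ) ≠ 0 := mul_ne_zero I_ne_zero (by exact_mod_cast hk)
    have : ∀ t : ℝ, cexp (I * (t * k)) = cexp ((I * k) * t) := fun t => by ring_nf
    simp_rw [this]
    rw [integral_exp_mul_complex hk', div_eq_zero_iff]
    left
    rw [sub_eq_zero, Complex.exp_eq_exp_iff_exists_int]
    exact ⟨k, by push_cast; ring⟩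

/-! ### The dual cell and the characters of the lattice -/

section cell

variable {m : ℕ}

/-- The cell `{θ : |⟨b_j, θ⟩| ≤ π}` of the lattice dual to that spanned by `b`. -/
def dualCell (b : Module.Basis (Fin m) ℝ (EuclideanSpace ℝ (Fin m))) :
    Set (EuclideanSpace ℝ (Fin m)) := {θ | ∀ j, |inner ℝ (b j) θ| ≤ Real.pi}

variable (b : Module.Basis (Fin m) ℝ (EuclideanSpace ℝ (Fin m)))

theorem isClosed_dualCell : IsClosed (dualCell b) := by
  simp only [dualCell, Set.ofPred_forall]
  exact isClosed_iInter fun j => isClosed_le (by fun_prop) continuous_const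

/-- The coordinates `θ ↦ (⟨b_j, θ⟩)_j`. -/
def dualCoord : EuclideanSpace ℝ (Fin m) ≃L[ℝ] (Fin m → ℝ) :=
  (LinearEquiv.ofInjectiveOfFinrankEq
    (LinearMap.pi fun j => (innerSL ℝ (b j)).toLinearMap) (by
      rw [injective_iff_map_eq_zero]
      intro θ h
      refine InnerProductSpace.ext_inner_left_basis b fun j => ?_
      rw [inner_zero_right]
      exact congrFun h j) (by simp)).toContinuousLinearEquiv

theorem dualCoord_apply (θ : EuclideanSpace ℝ (Fin m)) (j : Fin m) :
    dualCoord b θ j = inner ℝ (b j) θ := rfl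

theorem exists_norm_sq_le_sum_inner_sq :
    ∃ C : ℝ, 0 < C ∧ ∀ θ, ‖θ‖ ^ 2 ≤ C * ∑ j, (inner ℝ (b j) θ) ^ 2 := by
  obtain ⟨K, hK, h⟩ := (dualCoord b).symm.toContinuousLinearMap.bound
  refine ⟨K ^ 2, by positivity, fun θ => ?_⟩
  have h1 := h (dualCoord b θ)
  have h2 : ‖dualCoord b θ‖ ^ 2 ≤ ∑ j, (inner ℝ (b j) θ) ^ 2 := by
    rw [← Real.le_sqrt (norm_nonneg _) (by positivity)]
    refine (pi_norm_le_iff_of_nonneg (by positivity)).2 fun j => Real.le_sqrt_of_sq_le ?_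
    rw [Real.norm_eq_abs, sq_abs, dualCoord_apply]
    exact Finset.single_le_sum (f := fun j => (inner ℝ (b j) θ) ^ 2)
      (fun i _ => sq_nonneg _) (Finset.mem_univ j)
  have h3 : ‖θ‖ ≤ K * ‖dualCoord b θ‖ := by simpa using h1
  calc ‖θ‖ ^ 2 ≤ (K * ‖dualCoord b θ‖) ^ 2 := by gcongr
    _ = K ^ 2 * ‖dualCoord b θ‖ ^ 2 := by ring
    _ ≤ _ := by gcongr

theorem exists_norm_le_of_mem_dualCell :
    ∃ R : ℝ, 0 < R ∧ ∀ θ ∈ dualCell b, ‖θ‖ ≤ R := by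
  obtain ⟨C, hC, h⟩ := exists_norm_sq_le_sum_inner_sq b
  refine ⟨√(C * ∑ _j : Fin m, Real.pi ^ 2) + 1, by positivity, fun θ hθ => ?_⟩
  refine le_trans (Real.le_sqrt_of_sq_le ((h θ).trans ?_)) (le_add_of_nonneg_right zero_le_one)
  refine mul_le_mul_of_nonneg_left (Finset.sum_le_sum fun j _ => ?_) hC.le
  exact sq_le_sq' (abs_le.1 (hθ j)).1 (abs_le.1 (hθ j)).2

/-- The cell contains a ball about the origin; this is what makes the Gaussian outside the cell
negligible. -/
theorem exists_le_norm_of_notMem_dualCell :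
    ∃ δ : ℝ, 0 < δ ∧ ∀ θ, θ ∉ dualCell b → δ ≤ ‖θ‖ := by
  have hpi := Real.pi_pos
  refine ⟨Real.pi / (∑ j, ‖b j‖ + 1), by positivity, fun θ hθ => ?_⟩
  simp only [dualCell, Set.mem_ofPred_eq, not_forall, not_le] at hθ
  obtain ⟨j, hj⟩ := hθ
  rw [div_le_iff₀ (by positivity)]
  have h1 : ‖b j‖ ≤ ∑ j, ‖b j‖ + 1 :=
    (Finset.single_le_sum (f := fun j => ‖b j‖) (fun i _ => norm_nonneg _)
      (Finset.mem_univ j)).trans (by linarith)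
  calc Real.pi ≤ ‖b j‖ * ‖θ‖ := hj.le.trans (abs_real_inner_le_norm _ _)
    _ ≤ _ := by rw [mul_comm]; gcongr

/-- Orthogonality of the characters of the lattice spanned by `b`. -/
theorem exists_integral_dualCell :
    ∃ κ : ℝ, 0 < κ ∧ ∀ y ∈ Submodule.span ℤ (Set.range b),
      ∫ θ in dualCell b, cexp (I * (inner ℝ θ y : ℝ)) = if y = 0 then (κ : ℂ) else 0 := by
  obtain ⟨c, hc, h⟩ := exists_integral_comp_equiv (volume : Measure (EuclideanSpace ℝ (Fin m)))
    (volume : Measure (Fin m → ℝ)) (dualCoord b)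
  have hpi := Real.pi_pos
  refine ⟨c * (2 * Real.pi) ^ m, by positivity, fun y hy => ?_⟩
  obtain ⟨k, hk⟩ := (Submodule.mem_span_range_iff_exists_fun ℤ).1 hy
  have h0 : y = 0 ↔ ∀ j, k j = 0 := by
    constructor
    · intro h j
      have hb := Fintype.linearIndependent_iff.1 b.linearIndependent (fun j => (k j : ℝ)) (by
        simpa only [Int.cast_smul_eq_zsmul] using hk.trans h) j
      exact_mod_cast hb
    · intro h; rw [← hk]; simp [h]
  rw [← integral_indicator (isClosed_dualCell b).measurableSet]
  -- In the coordinates $t_j=\langle b_j,\theta\rangle$ the cell is the cube $[-\pi,\pi]^m$ and the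
  -- character of $y=\sum_j k_jb_j$ is $\prod_j e^{it_jk_j}$, so the integral factors.
  have h1 : ∀ θ, (dualCell b).indicator (fun θ => cexp (I * (inner ℝ θ y : ℝ))) θ =
      (fun t : Fin m → ℝ => ∏ j, (Set.Icc (-Real.pi) Real.pi).indicator
        (fun t : ℝ => cexp (I * (t * k j))) (t j)) (dualCoord b θ) := by
    intro θ
    by_cases hθ : θ ∈ dualCell b
    · rw [Set.indicator_of_mem hθ]
      have : ∀ j, (Set.Icc (-Real.pi) Real.pi).indicator
        (fun t : ℝ => cexp (I * (t * k j))) (dualCoord b θ j) =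
          cexp (I * (dualCoord b θ j * k j)) := fun j =>
        Set.indicator_of_mem (Set.mem_Icc.2 (abs_le.1 (hθ j))) _
      simp only [this]
      rw [← Complex.exp_sum, ← Finset.mul_sum, ← hk, inner_sum]
      congr 2
      push_cast
      refine Finset.sum_congr rfl fun j _ => ?_
      rw [dualCoord_apply, ← Int.cast_smul_eq_zsmul ℝ, inner_smul_right, real_inner_comm]
      push_cast; ring
    · rw [Set.indicator_of_notMem hθ]
      simp only [dualCell, Set.mem_ofPred_eq, not_forall] at hθ
      obtain ⟨j, hj⟩ := hθ
      refine (Finset.prod_eq_zero (Finset.mem_univ j) ?_).symm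
      refine Set.indicator_of_notMem (fun h' => hj (abs_le.2 ?_)) _
      exact h'
  refine (integral_congr_ae (Filter.Eventually.of_forall h1)).trans
    ((h (fun t => ∏ j, (Set.Icc (-Real.pi) Real.pi).indicator
        (fun t : ℝ => cexp (I * (t * k j))) (t j))).trans ?_)
  rw [integral_fintype_prod_volume_eq_prod (fun j t => (Set.Icc (-Real.pi) Real.pi).indicator
        (fun t : ℝ => cexp (I * (t * k j))) t)]
  simp only [integral_Icc_cexp_int]
  split_ifs with hy0
  · simp [h0.1 hy0]
  · have : ∃ j, k j ≠ 0 := by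
      by_contra! h'
      exact hy0 (h0.2 h')
    obtain ⟨j, hj⟩ := this
    rw [Finset.prod_eq_zero (Finset.mem_univ j) (by simp [hj]), mul_zero]

end cell

/-! ### Positive definite forms and the Gaussian Fourier transform -/

section gaussian

variable {m : ℕ}

/-- A positive definite form is a squared norm after a linear change of variables. -/
theorem exists_equiv_of_posDef {M : Matrix (Fin m) (Fin m) ℝ} (hM : M.PosDef) :
    ∃ L N : EuclideanSpace ℝ (Fin m) ≃L[ℝ] EuclideanSpace ℝ (Fin m),
      (∀ θ, inner ℝ θ (WithLp.toLp 2 (M.mulVec θ.ofLp)) = ‖L θ‖ ^ 2) ∧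
      (∀ y, inner ℝ y (WithLp.toLp 2 (M⁻¹.mulVec y.ofLp)) = ‖N y‖ ^ 2) ∧
      ∀ θ y, inner ℝ (L θ) (N y) = inner ℝ θ y := by
  -- With $M=B^{T}B$, take $L=B$ and $N=(B^{-1})^{T}$; the two are dual, hence the last identity.
  obtain ⟨B, hB⟩ : ∃ B : Matrix (Fin m) (Fin m) ℝ, M = B.transpose * B := by
    open scoped MatrixOrder Matrix.Norms.L2Operator in
    obtain ⟨B, hB⟩ := CStarAlgebra.nonneg_iff_eq_star_mul_self.mp hM.posSemidef.nonneg
    exact ⟨B, by rw [hB, Matrix.star_eq_conjTranspose, Matrix.conjTranspose_eq_transpose_of_trivial]⟩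
  have hu : IsUnit B.det := by
    have := hM.isUnit
    rw [Matrix.isUnit_iff_isUnit_det, hB, Matrix.det_mul] at this
    exact isUnit_of_mul_isUnit_right this
  have hinv : M⁻¹ = B⁻¹ * (B⁻¹).transpose := by
    rw [hB, Matrix.mul_inv_rev, Matrix.transpose_nonsing_inv]
  have hu' : IsUnit (B⁻¹).transpose.det := by
    rw [Matrix.det_transpose]
    exact (Matrix.isUnit_nonsing_inv_det_iff).2 hu
  have key : ∀ (P : Matrix (Fin m) (Fin m) ℝ), IsUnit P.det →
      ∃ L : EuclideanSpace ℝ (Fin m) ≃L[ℝ] EuclideanSpace ℝ (Fin m),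
        ∀ v, L v = WithLp.toLp 2 (P.mulVec v.ofLp) := by
    intro P hP
    refine ⟨(LinearEquiv.ofInjectiveEndo (Matrix.toEuclideanLin P) ?_).toContinuousLinearEquiv,
      fun v => rfl⟩
    rw [injective_iff_map_eq_zero]
    intro v hv
    have h1 : P.mulVec v.ofLp = 0 := congrArg WithLp.ofLp hv
    have h2 := congrArg (P⁻¹.mulVec) h1
    rw [Matrix.mulVec_mulVec, Matrix.nonsing_inv_mul _ hP, Matrix.one_mulVec,
      Matrix.mulVec_zero] at h2
    exact WithLp.ofLp_injective 2 h2
  obtain ⟨L, hL⟩ := key B hu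
  obtain ⟨N, hN⟩ := key _ hu'
  have hin : ∀ (P Q : Matrix (Fin m) (Fin m) ℝ) (x y : EuclideanSpace ℝ (Fin m)),
      inner ℝ (WithLp.toLp 2 (P.mulVec x.ofLp) : EuclideanSpace ℝ (Fin m))
        (WithLp.toLp 2 (Q.mulVec y.ofLp)) =
      inner ℝ x (WithLp.toLp 2 ((P.transpose * Q).mulVec y.ofLp)) := by
    intro P Q x y
    simp only [EuclideanSpace.inner_eq_star_dotProduct, star_trivial]
    rw [dotProduct_comm, ← Matrix.mulVec_mulVec, dotProduct_comm _ x.ofLp,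
      Matrix.dotProduct_mulVec x.ofLp, Matrix.vecMul_transpose]
  refine ⟨L, N, fun θ => ?_, fun y => ?_, fun θ y => ?_⟩
  · rw [← real_inner_self_eq_norm_sq, hL, hin, hB]
  · rw [← real_inner_self_eq_norm_sq, hN, hin, hinv, Matrix.transpose_transpose]
  · rw [hL, hN, hin, ← Matrix.transpose_mul, Matrix.nonsing_inv_mul _ hu]
    simp

/-- Substituting $v=L\theta$ turns the phase into $\langle v,Ny\rangle$ by duality, and what remains
is the transform of an isotropic Gaussian. -/
theorem exists_integral_gaussian_fourier {L N : EuclideanSpace ℝ (Fin m) ≃L[ℝ]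
      EuclideanSpace ℝ (Fin m)} (hLN : ∀ θ y, inner ℝ (L θ) (N y) = inner ℝ θ y) :
    ∃ κ : ℝ, 0 < κ ∧ ∀ (n : ℝ), 0 < n → ∀ y : EuclideanSpace ℝ (Fin m),
      ∫ θ, cexp (-(I * (inner ℝ θ y : ℝ))) * (Real.exp (-(n * ‖L θ‖ ^ 2 / 2)) : ℝ) =
        ((κ * n ^ (-((m : ℝ) / 2)) * Real.exp (-(‖N y‖ ^ 2 / (2 * n))) : ℝ) : ℂ) := by
  obtain ⟨c, hc, h⟩ := exists_integral_comp_equiv (volume : Measure (EuclideanSpace ℝ (Fin m)))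
    (volume : Measure (EuclideanSpace ℝ (Fin m))) L
  have hpi := Real.pi_pos
  refine ⟨c * (2 * Real.pi) ^ ((m : ℝ) / 2), by positivity, fun n hn y => ?_⟩
  have h1 : ∀ θ, cexp (-(I * (inner ℝ θ y : ℝ))) * (Real.exp (-(n * ‖L θ‖ ^ 2 / 2)) : ℝ) =
      (fun v => cexp (-((n / 2 : ℝ) : ℂ) * ‖v‖ ^ 2 + (-I) * (inner ℝ (N y) v : ℝ))) (L θ) := by
    intro θ
    simp only
    rw [← hLN, ofReal_exp, ← Complex.exp_add, real_inner_comm]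
    congr 1
    push_cast; ring
  refine (integral_congr_ae (Filter.Eventually.of_forall h1)).trans
    ((h (fun v => cexp (-((n / 2 : ℝ) : ℂ) * ‖v‖ ^ 2 + (-I) * (inner ℝ (N y) v : ℝ)))).trans ?_)
  rw [GaussianFourier.integral_cexp_neg_mul_sq_norm_add (by
    rw [ofReal_re]; positivity)]
  have h2 : ((Real.pi : ℂ) / ((n / 2 : ℝ) : ℂ)) ^
      ((Module.finrank ℝ (EuclideanSpace ℝ (Fin m)) : ℂ) / 2) =
      (((2 * Real.pi) ^ ((m : ℝ) / 2) * n ^ (-((m : ℝ) / 2)) : ℝ) : ℂ) := by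
    rw [finrank_euclideanSpace, Fintype.card_fin, Real.rpow_neg hn.le, ← Real.inv_rpow hn.le,
      ← Real.mul_rpow (by positivity) (by positivity), ofReal_cpow (by positivity)]
    push_cast
    congr 1
    field_simp
  rw [h2]
  push_cast
  rw [mul_assoc, mul_assoc, mul_assoc]
  congr 3
  congr 1
  rw [neg_sq, I_sq]
  field_simp
  norm_num

end gaussian

/-! ### Powers of an operator close to one that contracts a given vector -/

section perturbation

variable {W : Type*} [NormedAddCommGroup W] [NormedSpace ℂ W] {T T₀ : W →ₗ[ℂ] W} {γ ρ ε : ℝ}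

theorem norm_pow_apply_le (hγ : 0 ≤ γ) (hT : ∀ h, ‖T h‖ ≤ γ * ‖h‖) (n : ℕ) (h : W) :
    ‖(T ^ n) h‖ ≤ γ ^ n * ‖h‖ := by
  induction n with
  | zero => simp
  | succ n ih =>
    rw [pow_succ', Module.End.mul_apply]
    calc ‖T ((T ^ n) h)‖ ≤ γ * ‖(T ^ n) h‖ := hT _
      _ ≤ γ * (γ ^ n * ‖h‖) := by gcongr
      _ = _ := by ring

/-- The powers of `T` on a vector that is contracted faster by the powers of a nearby `T₀`. -/
theorem norm_pow_apply_le_of_near (hγ : 0 < γ) (hρ : 0 ≤ ρ) (hρ1 : ρ < 1) (hε : 0 ≤ ε)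
    (hT : ∀ h, ‖T h‖ ≤ γ * ‖h‖) (hd : ∀ h, ‖T h - T₀ h‖ ≤ ε * ‖h‖) {r : W}
    (hr : ∀ k, ‖(T₀ ^ k) r‖ ≤ (ρ * γ) ^ k * ‖r‖) (n : ℕ) :
    ‖(T ^ n) r‖ ≤ γ ^ n * (ρ ^ n + ε / (γ * (1 - ρ))) * ‖r‖ := by
  have h1 : 0 < 1 - ρ := by linarith
  have key : ∀ n : ℕ, ‖(T ^ n) r - (T₀ ^ n) r‖ ≤
      γ ^ n * (ε / γ) * ((1 - ρ ^ n) / (1 - ρ)) * ‖r‖ := by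
    intro n
    induction n with
    | zero => simp
    | succ n ih =>
      -- Telescoping: an error committed at time $k$ is at most $\varepsilon(\rho\gamma)^k\|r\|$ and
      -- then grows at rate $\gamma$. Because `hr` beats $\gamma$ by the fixed factor $\rho$, the
      -- errors form a geometric series and their number does not matter.
      have e : (T ^ (n + 1)) r - (T₀ ^ (n + 1)) r =
          T ((T ^ n) r - (T₀ ^ n) r) + (T ((T₀ ^ n) r) - T₀ ((T₀ ^ n) r)) := by
        simp only [pow_succ', Module.End.mul_apply, map_sub]; abel
      rw [e]
      calc _ ≤ ‖T ((T ^ n) r - (T₀ ^ n) r)‖ + ‖T ((T₀ ^ n) r) - T₀ ((T₀ ^ n) r)‖ :=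
            norm_add_le _ _
        _ ≤ γ * (γ ^ n * (ε / γ) * ((1 - ρ ^ n) / (1 - ρ)) * ‖r‖) +
            ε * ((ρ * γ) ^ n * ‖r‖) := by
          gcongr
          · exact (hT _).trans (by gcongr)
          · exact (hd _).trans (by gcongr; exact hr n)
        _ = _ := by
          rw [mul_pow]
          field_simp
          ring
  have hn : 0 ≤ ρ ^ n := by positivity
  calc ‖(T ^ n) r‖ = ‖(T₀ ^ n) r + ((T ^ n) r - (T₀ ^ n) r)‖ := by congr 1; abel
    _ ≤ (ρ * γ) ^ n * ‖r‖ + γ ^ n * (ε / γ) * ((1 - ρ ^ n) / (1 - ρ)) * ‖r‖ :=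
      (norm_add_le _ _).trans (add_le_add (hr n) (key n))
    _ ≤ (ρ * γ) ^ n * ‖r‖ + γ ^ n * (ε / γ) * (1 / (1 - ρ)) * ‖r‖ := by
      gcongr; linarith
    _ = _ := by
      rw [mul_pow]; field_simp

/-- The powers of `T` on an approximate eigenvector. -/
theorem norm_pow_apply_sub_le (hγ : 0 < γ) (hρ : 0 ≤ ρ) (hρ1 : ρ < 1) (hε : 0 ≤ ε)
    (hT : ∀ h, ‖T h‖ ≤ γ * ‖h‖) (hd : ∀ h, ‖T h - T₀ h‖ ≤ ε * ‖h‖) {l : ℝ} (hl : 0 ≤ l)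
    (hlγ : l ≤ γ) {e ζ₀ ζ₁ : W} (he : T e - (l : ℂ) • e = ζ₀ + ζ₁)
    (hr : ∀ k, ‖(T₀ ^ k) ζ₀‖ ≤ (ρ * γ) ^ k * ‖ζ₀‖) (n : ℕ) :
    ‖(T ^ n) e - ((l ^ n : ℝ) : ℂ) • e‖ ≤
      γ ^ n * γ⁻¹ * (‖ζ₀‖ / (1 - ρ) + n * (ε / (γ * (1 - ρ)) * ‖ζ₀‖ + ‖ζ₁‖)) := by
  have h1 : 0 < 1 - ρ := by linarith
  have key : ∀ n : ℕ, ‖(T ^ n) e - ((l ^ n : ℝ) : ℂ) • e‖ ≤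
      γ ^ n * γ⁻¹ * (‖ζ₀‖ * ((1 - ρ ^ n) / (1 - ρ)) +
        n * (ε / (γ * (1 - ρ)) * ‖ζ₀‖ + ‖ζ₁‖)) := by
    intro n
    induction n with
    | zero => simp
    | succ n ih =>
      -- The defect is fed back at every step. The part $\zeta_0$ decays, so over $n$ steps it
      -- contributes $\|\zeta_0\|/(1-\rho)$ plus $n$ times $\varepsilon\|\zeta_0\|$; only $\zeta_1$
      -- accumulates in full. With $\varepsilon\sim|\theta|$, $\zeta_0\sim|\theta|^2$ and
      -- $\zeta_1\sim|\theta|^3$ the total is of order $|\theta|^2+n|\theta|^3$.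
      have e1 : (T ^ (n + 1)) e - ((l ^ (n + 1) : ℝ) : ℂ) • e =
          (T ^ n) ζ₀ + (T ^ n) ζ₁ + (l : ℂ) • ((T ^ n) e - ((l ^ n : ℝ) : ℂ) • e) := by
        rw [← map_add, ← he, pow_succ, Module.End.mul_apply, map_sub, map_smul, smul_sub, smul_smul,
          pow_succ']
        push_cast
        abel
      rw [e1]
      calc _ ≤ ‖(T ^ n) ζ₀‖ + ‖(T ^ n) ζ₁‖ + ‖(l : ℂ) • ((T ^ n) e - ((l ^ n : ℝ) : ℂ) • e)‖ :=
            norm_add₃_le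
        _ ≤ γ ^ n * (ρ ^ n + ε / (γ * (1 - ρ))) * ‖ζ₀‖ + γ ^ n * ‖ζ₁‖ +
            γ * (γ ^ n * γ⁻¹ * (‖ζ₀‖ * ((1 - ρ ^ n) / (1 - ρ)) +
              n * (ε / (γ * (1 - ρ)) * ‖ζ₀‖ + ‖ζ₁‖))) := by
          rw [norm_smul, Complex.norm_real, Real.norm_of_nonneg hl]
          gcongr
          · exact norm_pow_apply_le_of_near hγ hρ hρ1 hε hT hd hr n
          · exact norm_pow_apply_le hγ.le hT n _
        _ = _ := by
          push_cast
          field_simp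
          ring
  refine (key n).trans ?_
  have hn : 0 ≤ ρ ^ n := by positivity
  refine mul_le_mul_of_nonneg_left (add_le_add_left ?_ _) (by positivity)
  rw [div_eq_mul_one_div ‖ζ₀‖]
  gcongr
  linarith

end perturbation

/-! ### Twisted transition operators, energy and Poincaré inequalities -/

/-- A lower bound for the variance by the deviations from the value at one point. -/
theorem norm_sum_smul_sq_le {ι F : Type*} [NormedAddCommGroup F] [InnerProductSpace ℝ F]
    (S : Finset ι) (w : ι → ℝ) (hw : ∀ s ∈ S, 0 ≤ w s) (hw1 : ∑ s ∈ S, w s = 1) {o : ι}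
    (ho : o ∈ S) (z : ι → F) :
    ‖∑ s ∈ S, w s • z s‖ ^ 2 ≤
      ∑ s ∈ S, w s * ‖z s‖ ^ 2 - w o * ∑ s ∈ S, w s * ‖z s - z o‖ ^ 2 := by
  classical
  set D := ∑ s ∈ S, w s • (z s - z o)
  have e1 : ∑ s ∈ S, w s • z s = z o + D := by
    simp only [D, smul_sub, Finset.sum_sub_distrib, ← Finset.sum_smul, hw1, one_smul]
    abel
  have e2 : ∑ s ∈ S, w s * ‖z s‖ ^ 2 = ‖z o‖ ^ 2 + 2 * inner ℝ (z o) D +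
      ∑ s ∈ S, w s * ‖z s - z o‖ ^ 2 := by
    have : ∀ s ∈ S, w s * ‖z s‖ ^ 2 = w s * ‖z o‖ ^ 2 + 2 * inner ℝ (z o) (w s • (z s - z o)) +
        w s * ‖z s - z o‖ ^ 2 := by
      intro s _
      have : z s = z o + (z s - z o) := by abel
      conv_lhs => rw [this, norm_add_sq_real]
      rw [inner_smul_right]; ring
    rw [Finset.sum_congr rfl this, Finset.sum_add_distrib, Finset.sum_add_distrib,
      ← Finset.sum_mul, hw1, ← Finset.mul_sum, ← inner_sum, one_mul]
  -- The term $s=o$ of $D$ vanishes, so Cauchy–Schwarz only sees the total weight $1-w_o$; this is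
  -- the whole gain.
  have e3 : ‖D‖ ^ 2 ≤ (1 - w o) * ∑ s ∈ S, w s * ‖z s - z o‖ ^ 2 := by
    have h1 : D = ∑ s ∈ S.erase o, w s • (z s - z o) := by
      simp only [D]
      rw [← Finset.add_sum_erase S _ ho]; simp
    have h2 : ∑ s ∈ S, w s * ‖z s - z o‖ ^ 2 = ∑ s ∈ S.erase o, w s * ‖z s - z o‖ ^ 2 := by
      rw [← Finset.add_sum_erase S _ ho]; simp
    have h3 : 1 - w o = ∑ s ∈ S.erase o, w s := by
      rw [← hw1, ← Finset.add_sum_erase S _ ho]; ring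
    rw [h1, h2, h3]
    calc ‖∑ s ∈ S.erase o, w s • (z s - z o)‖ ^ 2
        ≤ (∑ s ∈ S.erase o, w s * ‖z s - z o‖) ^ 2 := by
          gcongr
          refine norm_sum_le_of_le _ fun s hs => ?_
          rw [norm_smul, Real.norm_of_nonneg (hw s (Finset.mem_of_mem_erase hs))]
      _ ≤ _ := Finset.sum_sq_le_sum_mul_sum_of_sq_le_mul _
          (fun s hs => hw s (Finset.mem_of_mem_erase hs))
          (fun s hs => mul_nonneg (hw s (Finset.mem_of_mem_erase hs)) (sq_nonneg _))
          (fun s _ => by apply le_of_eq; ring)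
  rw [e1, e2, norm_add_sq_real]
  linarith

namespace SymmetricLaw

variable {Γ : Type*} [Group Γ] (μ : SymmetricLaw Γ)

theorem mass_nonneg (s : Γ) : 0 ≤ μ.mass s := ENNReal.toReal_nonneg

theorem sum_mass : ∑ s ∈ μ.S, μ.mass s = 1 := by
  have h := μ.toPMF.tsum_coe
  rw [tsum_eq_sum (s := μ.S) (fun s hs => by
    rwa [mem_S, PMF.mem_support_iff, not_not] at hs)] at h
  rw [← ENNReal.toReal_one, ← h, ENNReal.toReal_sum fun s _ => μ.toPMF.apply_ne_top s]
  rfl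

end SymmetricLaw

namespace LatticeAction

variable {Γ : Type*} [Group Γ] {m : ℕ} (A : LatticeAction Γ m) (μ : SymmetricLaw Γ)

/-- A map `Γ → ℝᵐ` on which `Λ` acts by the same translations as on `Φ`. -/
def Equivariant (Ψ : Γ → EuclideanSpace ℝ (Fin m)) : Prop :=
  ∀ g ∈ A.Λ, ∀ x, Ψ (g * x) = A.Φ g + Ψ x

/-- The increment of `Ψ` along the edge `(v, s)`. -/
def incr (Ψ : Γ → EuclideanSpace ℝ (Fin m)) (v : A.Vertex) (s : Γ) : EuclideanSpace ℝ (Fin m) :=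
  Ψ (Quotient.out v * s) - Ψ (Quotient.out v)

theorem coset_out (v : A.Vertex) : A.coset (Quotient.out v) = v := Quotient.out_eq v

theorem coset_mul_of_mem {g : Γ} (hg : g ∈ A.Λ) (x : Γ) : A.coset (g * x) = A.coset x := by
  rw [eq_comm, A.coset_eq]; simpa

/-- The right action of `s` as a permutation of the vertices. -/
def stepEquiv (s : Γ) : A.Vertex ≃ A.Vertex :=
  ⟨fun v => A.step v s, fun v => A.step v s⁻¹, fun v => A.step_step_inv v s,
    fun v => A.step_inv_step v s⟩

variable {A} in
-- Representatives of a coset differ by an element of $\Lambda$, which shifts both values of $\Psi$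
-- by the same vector. So the choice made by `Quotient.out` in `incr` is harmless.
theorem Equivariant.incr_coset {Ψ : Γ → EuclideanSpace ℝ (Fin m)} (hΨ : A.Equivariant Ψ)
    (x s : Γ) : A.incr Ψ (A.coset x) s = Ψ (x * s) - Ψ x := by
  set y := Quotient.out (A.coset x) with hy
  have h : A.coset y = A.coset x := A.coset_out _
  have hg : y * x⁻¹ ∈ A.Λ := (A.coset_eq).1 h.symm
  have e1 : y = y * x⁻¹ * x := by group
  have e2 : y * s = y * x⁻¹ * (x * s) := by group
  change Ψ (y * s) - Ψ y = _
  rw [e2, hΨ _ hg]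
  conv_lhs => rw [e1, hΨ _ hg]
  simp

/-- The transition operator twisted by the character `θ`, on functions on the vertices. -/
def twist (Ψ : Γ → EuclideanSpace ℝ (Fin m)) (θ : EuclideanSpace ℝ (Fin m)) :
    EuclideanSpace ℂ A.Vertex →ₗ[ℂ] EuclideanSpace ℂ A.Vertex where
  toFun h := WithLp.toLp 2 fun v =>
    ∑ s ∈ μ.S, μ.mass s • (cexp (I * (inner ℝ θ (A.incr Ψ v s) : ℝ)) * h (A.step v s))
  map_add' h k := by
    ext v
    simp [mul_add, Finset.sum_add_distrib]
  map_smul' c h := by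
    ext v
    simp only [PiLp.smul_apply, smul_eq_mul, RingHom.id_apply, Finset.mul_sum]
    refine Finset.sum_congr rfl fun s _ => ?_
    simp only [Complex.real_smul]; ring

theorem twist_apply (Ψ : Γ → EuclideanSpace ℝ (Fin m)) (θ : EuclideanSpace ℝ (Fin m))
    (h : EuclideanSpace ℂ A.Vertex) (v : A.Vertex) :
    A.twist μ Ψ θ h v =
      ∑ s ∈ μ.S, μ.mass s • (cexp (I * (inner ℝ θ (A.incr Ψ v s) : ℝ)) * h (A.step v s)) := rfl

/-- The Dirichlet energy twisted by the character `θ`. -/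
def energy (Ψ : Γ → EuclideanSpace ℝ (Fin m)) (θ : EuclideanSpace ℝ (Fin m))
    (h : EuclideanSpace ℂ A.Vertex) : ℝ :=
  ∑ v, ∑ s ∈ μ.S,
    μ.mass s * ‖cexp (I * (inner ℝ θ (A.incr Ψ v s) : ℝ)) * h (A.step v s) - h v‖ ^ 2

variable (Ψ : Γ → EuclideanSpace ℝ (Fin m)) (θ : EuclideanSpace ℝ (Fin m))

theorem norm_cexp_I_mul (x : ℝ) : ‖cexp (I * x)‖ = 1 := by
  rw [mul_comm, Complex.norm_exp_ofReal_mul_I]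

/-- The phases are unimodular and the step $1$ reproduces $h(v)$ itself, so `norm_sum_smul_sq_le`
applies at each vertex with base point $1$; each step permutes the vertices, so the first terms add
up to $\|h\|^2$. Here the holding probability $\mu(1)$ excludes periodicity. -/
theorem norm_twist_sq_le (h1 : (1 : Γ) ∈ μ.S) (h : EuclideanSpace ℂ A.Vertex) :
    ‖A.twist μ Ψ θ h‖ ^ 2 ≤ ‖h‖ ^ 2 - μ.mass 1 * A.energy μ Ψ θ h := by
  have hstep : ∀ v : A.Vertex, A.step v 1 = v := fun v => by
    rw [← A.coset_out v, step_coset, mul_one]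
  have hincr : ∀ v : A.Vertex, A.incr Ψ v 1 = 0 := fun v => by simp [incr]
  have hpt : ∀ v : A.Vertex, ‖A.twist μ Ψ θ h v‖ ^ 2 ≤
      ∑ s ∈ μ.S, μ.mass s * ‖h (A.step v s)‖ ^ 2 - μ.mass 1 * ∑ s ∈ μ.S,
    μ.mass s * ‖cexp (I * (inner ℝ θ (A.incr Ψ v s) : ℝ)) * h (A.step v s) - h v‖ ^ 2 := by
    intro v
    have := norm_sum_smul_sq_le μ.S μ.mass (fun s _ => μ.mass_nonneg s) μ.sum_mass h1
      (fun s => cexp (I * (inner ℝ θ (A.incr Ψ v s) : ℝ)) * h (A.step v s))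
    rw [twist_apply]
    simpa [norm_cexp_I_mul, hstep, hincr] using this
  have hsum : ∑ v, ∑ s ∈ μ.S, μ.mass s * ‖h (A.step v s)‖ ^ 2 = ∑ v, ‖h v‖ ^ 2 := by
    rw [Finset.sum_comm]
    simp_rw [← Finset.mul_sum]
    have : ∀ s, ∑ v, ‖h (A.step v s)‖ ^ 2 = ∑ v, ‖h v‖ ^ 2 := fun s =>
      Equiv.sum_comp (A.stepEquiv s) fun v => ‖h v‖ ^ 2
    simp_rw [this]
    rw [← Finset.sum_mul, μ.sum_mass, one_mul]
  rw [EuclideanSpace.norm_sq_eq, EuclideanSpace.norm_sq_eq, energy, ← hsum, Finset.mul_sum,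
    ← Finset.sum_sub_distrib]
  exact Finset.sum_le_sum fun v _ => hpt v

/-- The function on `Γ` with character `θ` under `Λ` that corresponds to a function on the
vertices. -/
def lift (h : EuclideanSpace ℂ A.Vertex) (x : Γ) : ℂ :=
  cexp (I * (inner ℝ θ (Ψ x) : ℝ)) * h (A.coset x)

theorem norm_lift (h : EuclideanSpace ℂ A.Vertex) (x : Γ) :
    ‖A.lift Ψ θ h x‖ = ‖h (A.coset x)‖ := by
  rw [lift, norm_mul, norm_cexp_I_mul, one_mul]

variable {A Ψ} in
theorem Equivariant.lift_mul (hΨ : A.Equivariant Ψ) (h : EuclideanSpace ℂ A.Vertex) (x s : Γ) :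
    A.lift Ψ θ h (x * s) = cexp (I * (inner ℝ θ (Ψ x) : ℝ)) *
      (cexp (I * (inner ℝ θ (A.incr Ψ (A.coset x) s) : ℝ)) * h (A.step (A.coset x) s)) := by
  rw [hΨ.incr_coset, lift, step_coset, ← mul_assoc, ← Complex.exp_add, ← mul_add,
    ← Complex.ofReal_add, ← inner_add_right, add_sub_cancel]

variable {A Ψ} in
theorem Equivariant.lift_mul_of_mem (hΨ : A.Equivariant Ψ) (h : EuclideanSpace ℂ A.Vertex) {g : Γ}
    (hg : g ∈ A.Λ) (x : Γ) :
    A.lift Ψ θ h (g * x) = cexp (I * (inner ℝ θ (A.Φ g) : ℝ)) * A.lift Ψ θ h x := by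
  rw [lift, lift, hΨ g hg, A.coset_mul_of_mem hg, inner_add_right, ← mul_assoc, ← Complex.exp_add]
  push_cast; ring_nf

variable {A Ψ} in
theorem Equivariant.norm_lift_mul_sub_sq_le (hΨ : A.Equivariant Ψ) {s : Γ} (hs : s ∈ μ.S)
    (θ : EuclideanSpace ℝ (Fin m)) (h : EuclideanSpace ℂ A.Vertex) (x : Γ) :
    ‖A.lift Ψ θ h (x * s) - A.lift Ψ θ h x‖ ^ 2 ≤ (μ.mass s)⁻¹ * A.energy μ Ψ θ h := by
  have hm := μ.mass_pos hs
  rw [inv_mul_eq_div, le_div_iff₀ hm, hΨ.lift_mul, lift, ← mul_sub, norm_mul, norm_cexp_I_mul,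
    one_mul, mul_comm]
  have hnn : ∀ v s, 0 ≤ μ.mass s *
      ‖cexp (I * (inner ℝ θ (A.incr Ψ v s) : ℝ)) * h (A.step v s) - h v‖ ^ 2 :=
    fun v s => mul_nonneg (μ.mass_nonneg s) (sq_nonneg _)
  exact (Finset.single_le_sum (f := fun s => μ.mass s *
      ‖cexp (I * (inner ℝ θ (A.incr Ψ (A.coset x) s) : ℝ)) * h (A.step (A.coset x) s) -
        h (A.coset x)‖ ^ 2) (fun s _ => hnn _ s) hs).trans
    (Finset.single_le_sum (f := fun v => ∑ s ∈ μ.S, μ.mass s *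
      ‖cexp (I * (inner ℝ θ (A.incr Ψ v s) : ℝ)) * h (A.step v s) - h v‖ ^ 2)
      (fun v _ => Finset.sum_nonneg fun s _ => hnn v s) (Finset.mem_univ (A.coset x)))

theorem energy_nonneg (h : EuclideanSpace ℂ A.Vertex) : 0 ≤ A.energy μ Ψ θ h :=
  Finset.sum_nonneg fun _ _ => Finset.sum_nonneg fun s _ =>
    mul_nonneg (μ.mass_nonneg s) (sq_nonneg _)

variable {A Ψ μ} in
-- Write $g$ as a product of elements of $S$ and chain the edge estimates along the path. On the
-- lift to $\Gamma$ the estimate for a single edge holds at every base point, so the constant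
-- depends on $g$ alone.
theorem Equivariant.exists_norm_lift_mul_sub_sq_le (hΨ : A.Equivariant Ψ)
    (hgen : Subsemigroup.closure μ.toPMF.support = ⊤) (g : Γ) :
    ∃ C : ℝ, 0 < C ∧ ∀ θ h x,
      ‖A.lift Ψ θ h (x * g) - A.lift Ψ θ h x‖ ^ 2 ≤ C * A.energy μ Ψ θ h := by
  have hg : g ∈ Subsemigroup.closure μ.toPMF.support := hgen ▸ Subsemigroup.mem_top g
  induction hg using Subsemigroup.closure_induction with
  | mem s hs =>
    have hs' : s ∈ μ.S := μ.mem_S.2 hs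
    exact ⟨(μ.mass s)⁻¹, inv_pos.2 (μ.mass_pos hs'), hΨ.norm_lift_mul_sub_sq_le μ hs'⟩
  | mul g k _ _ hg hk =>
    obtain ⟨C, hC, h1⟩ := hg
    obtain ⟨D, hD, h2⟩ := hk
    refine ⟨2 * (C + D), by positivity, fun θ h x => ?_⟩
    have e : A.lift Ψ θ h (x * (g * k)) - A.lift Ψ θ h x =
        (A.lift Ψ θ h (x * g * k) - A.lift Ψ θ h (x * g)) +
          (A.lift Ψ θ h (x * g) - A.lift Ψ θ h x) := by
      rw [mul_assoc]; ring
    rw [e]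
    have h3 := h1 θ h x
    have h4 := h2 θ h (x * g)
    calc _ ≤ (‖A.lift Ψ θ h (x * g * k) - A.lift Ψ θ h (x * g)‖ +
          ‖A.lift Ψ θ h (x * g) - A.lift Ψ θ h x‖) ^ 2 := by gcongr; exact norm_add_le _ _
      _ ≤ _ := add_sq_le
      _ ≤ _ := by linarith

variable {A Ψ μ} in
/-- The Poincaré inequality for the twisted energy. -/
theorem Equivariant.exists_norm_sq_mul_le_energy (hΨ : A.Equivariant Ψ)
    (hgen : Subsemigroup.closure μ.toPMF.support = ⊤)
    {b : Module.Basis (Fin m) ℝ (EuclideanSpace ℝ (Fin m))}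
    (hb : ∀ j, ∃ g ∈ A.Λ, A.Φ g = b j) :
    ∃ C : ℝ, 0 < C ∧ ∀ θ ∈ dualCell b, ∀ h,
      ‖θ‖ ^ 2 * ‖h‖ ^ 2 ≤ C * A.energy μ Ψ θ h := by
  choose g hg hgb using hb
  -- The conjugate $w^{-1}g_jw$ is chosen so that moving right by it from $w$ is moving left by
  -- $g_j\in\Lambda$, which multiplies the lift by $e^{i\langle\theta,b_j\rangle}$.
  choose C hC hCle using fun (v : A.Vertex) (j : Fin m) =>
    hΨ.exists_norm_lift_mul_sub_sq_le hgen ((Quotient.out v)⁻¹ * g j * Quotient.out v)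
  obtain ⟨K, hK, hKle⟩ := exists_norm_sq_le_sum_inner_sq b
  refine ⟨K * (Real.pi / 2) ^ 2 * ∑ j, ∑ v, C v j + 1, ?_, fun θ hθ h => ?_⟩
  · have : 0 ≤ ∑ j, ∑ v, C v j :=
      Finset.sum_nonneg fun j _ => Finset.sum_nonneg fun v _ => (hC v j).le
    positivity
  have hpi := Real.pi_pos
  have hE := A.energy_nonneg μ Ψ θ h
  have hj : ∀ j v, (inner ℝ (b j) θ) ^ 2 * ‖h v‖ ^ 2 ≤
      (Real.pi / 2) ^ 2 * (C v j * A.energy μ Ψ θ h) := by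
    intro j v
    have h1 := hCle v j θ h (Quotient.out v)
    rw [← mul_assoc, ← mul_assoc, mul_inv_cancel, one_mul, hΨ.lift_mul_of_mem θ h (hg j), hgb,
      ← sub_one_mul, norm_mul, norm_lift, A.coset_out, mul_pow] at h1
    -- Jordan's inequality, $|t|\le\frac{\pi}{2}|e^{it}-1|$ for $|t|\le\pi$; this is where $\theta$
    -- must lie in the cell.
    have h2 : |inner ℝ (b j) θ| ≤ Real.pi / 2 * ‖cexp (I * (inner ℝ θ (b j) : ℝ)) - 1‖ := by
      rw [Complex.norm_exp_I_mul_ofReal_sub_one, norm_mul, Real.norm_ofNat, real_inner_comm]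
      have h3 := Real.mul_abs_le_abs_sin (x := inner ℝ (b j) θ / 2) (by
        rw [abs_div, abs_two]; linarith [hθ j])
      rw [abs_div, abs_two, real_inner_comm] at h3
      rw [Real.norm_eq_abs]
      field_simp at h3 ⊢
      linarith
    have h4 : (inner ℝ (b j) θ) ^ 2 ≤
        (Real.pi / 2 * ‖cexp (I * (inner ℝ θ (b j) : ℝ)) - 1‖) ^ 2 := by
      rw [← sq_abs]; gcongr
    calc _ ≤ (Real.pi / 2 * ‖cexp (I * (inner ℝ θ (b j) : ℝ)) - 1‖) ^ 2 * ‖h v‖ ^ 2 := by gcongr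
      _ = (Real.pi / 2) ^ 2 * (‖cexp (I * (inner ℝ θ (b j) : ℝ)) - 1‖ ^ 2 * ‖h v‖ ^ 2) := by ring
      _ ≤ _ := by gcongr
  calc ‖θ‖ ^ 2 * ‖h‖ ^ 2 ≤ (K * ∑ j, (inner ℝ (b j) θ) ^ 2) * ‖h‖ ^ 2 := by
        gcongr; exact hKle θ
    _ = K * ∑ j, ∑ v, (inner ℝ (b j) θ) ^ 2 * ‖h v‖ ^ 2 := by
      rw [EuclideanSpace.norm_sq_eq, mul_assoc, Finset.sum_mul]
      simp_rw [Finset.mul_sum]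
    _ ≤ K * ∑ j, ∑ v, (Real.pi / 2) ^ 2 * (C v j * A.energy μ Ψ θ h) := by
      exact mul_le_mul_of_nonneg_left
        (Finset.sum_le_sum fun j _ => Finset.sum_le_sum fun v _ => hj j v) hK.le
    _ = K * (Real.pi / 2) ^ 2 * (∑ j, ∑ v, C v j) * A.energy μ Ψ θ h := by
      simp_rw [← Finset.mul_sum, ← Finset.sum_mul]; ring
    _ ≤ _ := by nlinarith

variable {A Ψ μ} in
/-- The Poincaré inequality for functions of mean zero. -/
theorem Equivariant.exists_norm_sq_le_energy (hΨ : A.Equivariant Ψ)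
    (hgen : Subsemigroup.closure μ.toPMF.support = ⊤) :
    ∃ C : ℝ, 0 < C ∧ ∀ h : EuclideanSpace ℂ A.Vertex, ∑ v, h v = 0 →
      ‖h‖ ^ 2 ≤ C * A.energy μ Ψ 0 h := by
  -- At $\theta=0$ the lift is $h$ composed with the projection, so the step from $w$ to $v$
  -- compares $h$ at two vertices.
  choose C hC hCle using fun (v w : A.Vertex) =>
    hΨ.exists_norm_lift_mul_sub_sq_le hgen ((Quotient.out w)⁻¹ * Quotient.out v)
  refine ⟨∑ v, ∑ w, C v w, Finset.sum_pos (fun v _ => Finset.sum_pos (fun w _ => hC v w)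
    Finset.univ_nonempty) Finset.univ_nonempty, fun h hh => ?_⟩
  have h1 : ∀ v w, ‖h v - h w‖ ^ 2 ≤ C v w * A.energy μ Ψ 0 h := by
    intro v w
    have := hCle v w 0 h (Quotient.out w)
    rwa [← mul_assoc, mul_inv_cancel, one_mul, lift, lift, inner_zero_left, inner_zero_left,
      coset_out, coset_out, Complex.ofReal_zero, mul_zero, Complex.exp_zero, one_mul,
      one_mul] at this
  have hcard : (0 : ℝ) < Fintype.card A.Vertex := by exact_mod_cast Fintype.card_pos
  have h2 : ∀ v, ‖h v‖ ^ 2 ≤ ∑ w, C v w * A.energy μ Ψ 0 h := by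
    intro v
    have e : (Fintype.card A.Vertex : ℂ) * h v = ∑ w, (h v - h w) := by
      rw [Finset.sum_sub_distrib, hh]; simp
    have h3 : (Fintype.card A.Vertex : ℝ) * ‖h v‖ ≤ ∑ w, ‖h v - h w‖ := by
      rw [← Complex.norm_natCast, ← norm_mul, e]; exact norm_sum_le _ _
    have h4 : (∑ w, ‖h v - h w‖) ^ 2 ≤ Fintype.card A.Vertex * ∑ w, ‖h v - h w‖ ^ 2 :=
      sq_sum_le_card_mul_sum_sq
    have h5 : ((Fintype.card A.Vertex : ℝ) * ‖h v‖) ^ 2 ≤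
        Fintype.card A.Vertex * ∑ w, ‖h v - h w‖ ^ 2 :=
      (pow_le_pow_left₀ (by positivity) h3 2).trans h4
    have hc1 : (1 : ℝ) ≤ Fintype.card A.Vertex := by exact_mod_cast Fintype.card_pos
    calc ‖h v‖ ^ 2 ≤ Fintype.card A.Vertex * ‖h v‖ ^ 2 := le_mul_of_one_le_left (sq_nonneg _) hc1
      _ ≤ ∑ w, ‖h v - h w‖ ^ 2 := by
        refine le_of_mul_le_mul_left ?_ hcard
        calc _ = ((Fintype.card A.Vertex : ℝ) * ‖h v‖) ^ 2 := by ring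
          _ ≤ _ := h5
      _ ≤ _ := Finset.sum_le_sum fun w _ => h1 v w
  rw [EuclideanSpace.norm_sq_eq]
  calc _ ≤ ∑ v, ∑ w, C v w * A.energy μ Ψ 0 h := Finset.sum_le_sum fun v _ => h2 v
    _ = _ := by simp_rw [← Finset.sum_mul]

variable {A Ψ μ} in
-- By $1-x\le e^{-x}$ the Poincaré loss becomes a Gaussian factor, a form suited to taking $n$-th
-- powers and integrating over $\theta$.
theorem Equivariant.exists_norm_twist_le (hΨ : A.Equivariant Ψ)
    (hgen : Subsemigroup.closure μ.toPMF.support = ⊤) (h1 : (1 : Γ) ∈ μ.S)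
    {b : Module.Basis (Fin m) ℝ (EuclideanSpace ℝ (Fin m))}
    (hb : ∀ j, ∃ g ∈ A.Λ, A.Φ g = b j) :
    ∃ c : ℝ, 0 < c ∧ ∀ θ ∈ dualCell b, ∀ h,
      ‖A.twist μ Ψ θ h‖ ≤ Real.exp (-(c * ‖θ‖ ^ 2)) * ‖h‖ := by
  obtain ⟨C, hC, hle⟩ := hΨ.exists_norm_sq_mul_le_energy hgen hb
  have hm := μ.mass_pos h1
  refine ⟨μ.mass 1 / C / 2, by positivity, fun θ hθ h => ?_⟩
  refine le_of_sq_le_sq ?_ (by positivity)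
  refine (A.norm_twist_sq_le μ Ψ θ h1 h).trans ?_
  have h2 := hle θ hθ h
  have h3 : ‖θ‖ ^ 2 * ‖h‖ ^ 2 / C ≤ A.energy μ Ψ θ h := by
    rw [div_le_iff₀ hC]; linarith
  calc _ ≤ ‖h‖ ^ 2 - μ.mass 1 * (‖θ‖ ^ 2 * ‖h‖ ^ 2 / C) := by gcongr
    _ = (-(μ.mass 1 / C * ‖θ‖ ^ 2) + 1) * ‖h‖ ^ 2 := by ring
    _ ≤ Real.exp (-(μ.mass 1 / C * ‖θ‖ ^ 2)) * ‖h‖ ^ 2 := by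
      gcongr; exact Real.add_one_le_exp _
    _ = _ := by
      rw [mul_pow, ← Real.exp_nat_mul]; congr 2; push_cast; ring

theorem sum_twist_zero (h : EuclideanSpace ℂ A.Vertex) :
    ∑ v, A.twist μ Ψ 0 h v = ∑ v, h v := by
  simp only [twist_apply, inner_zero_left, Complex.ofReal_zero, mul_zero, Complex.exp_zero, one_mul]
  rw [Finset.sum_comm]
  simp_rw [← Finset.smul_sum]
  have : ∀ s, ∑ v, h (A.step v s) = ∑ v, h v := fun s =>
    Equiv.sum_comp (A.stepEquiv s) fun v => h v
  simp_rw [this]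
  rw [← Finset.sum_smul, μ.sum_mass, one_smul]

variable {A Ψ μ} in
theorem Equivariant.exists_norm_twist_zero_pow_le (hΨ : A.Equivariant Ψ)
    (hgen : Subsemigroup.closure μ.toPMF.support = ⊤) (h1 : (1 : Γ) ∈ μ.S) :
    ∃ ρ : ℝ, 0 < ρ ∧ ρ < 1 ∧ ∀ h : EuclideanSpace ℂ A.Vertex, ∑ v, h v = 0 →
      ∀ k, ‖(A.twist μ Ψ 0 ^ k) h‖ ≤ ρ ^ k * ‖h‖ := by
  obtain ⟨C, hC, hle⟩ := hΨ.exists_norm_sq_le_energy hgen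
  have hm := μ.mass_pos h1
  refine ⟨Real.exp (-(μ.mass 1 / C / 2)), Real.exp_pos _, by
    rw [Real.exp_lt_one_iff]; have : 0 < μ.mass 1 / C / 2 := by positivity
    linarith, fun h hh k => ?_⟩
  have hone : ∀ h : EuclideanSpace ℂ A.Vertex, ∑ v, h v = 0 →
      ‖A.twist μ Ψ 0 h‖ ≤ Real.exp (-(μ.mass 1 / C / 2)) * ‖h‖ := by
    intro h hh
    refine le_of_sq_le_sq ?_ (by positivity)
    refine (A.norm_twist_sq_le μ Ψ 0 h1 h).trans ?_
    have h3 : ‖h‖ ^ 2 / C ≤ A.energy μ Ψ 0 h := by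
      rw [div_le_iff₀ hC]; linarith [hle h hh]
    calc _ ≤ ‖h‖ ^ 2 - μ.mass 1 * (‖h‖ ^ 2 / C) := by gcongr
      _ = (-(μ.mass 1 / C) + 1) * ‖h‖ ^ 2 := by ring
      _ ≤ Real.exp (-(μ.mass 1 / C)) * ‖h‖ ^ 2 := by
        gcongr; exact Real.add_one_le_exp _
      _ = _ := by
        rw [mul_pow, ← Real.exp_nat_mul]; congr 2; push_cast; ring
  have hmean : ∀ k, ∑ v, (A.twist μ Ψ 0 ^ k) h v = 0 := by
    intro k
    induction k with
    | zero => simpa using hh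
    | succ k ih => rw [pow_succ', Module.End.mul_apply, sum_twist_zero, ih]
  induction k with
  | zero => simp
  | succ k ih =>
    rw [pow_succ', Module.End.mul_apply]
    calc _ ≤ _ := hone _ (hmean k)
      _ ≤ Real.exp (-(μ.mass 1 / C / 2)) * (Real.exp (-(μ.mass 1 / C / 2)) ^ k * ‖h‖) := by gcongr
      _ = _ := by ring

end LatticeAction

/-! ### The harmonic map, its covariance, and the approximate eigenvector -/

namespace LatticeAction

variable {Γ : Type*} [Group Γ] {m : ℕ} (A : LatticeAction Γ m) (μ : SymmetricLaw Γ)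

/-- The map `Ψ` has increments of mean zero at every vertex. -/
def HarmonicMap (Ψ : Γ → EuclideanSpace ℝ (Fin m)) : Prop :=
  ∀ v : A.Vertex, ∑ s ∈ μ.S, μ.mass s • A.incr Ψ v s = 0

/-- The covariance form `q(θ)` of the increments of `Ψ`. -/
def variance (Ψ : Γ → EuclideanSpace ℝ (Fin m)) (θ : EuclideanSpace ℝ (Fin m)) : ℝ :=
  A.unif * ∑ v, ∑ s ∈ μ.S, μ.mass s * (inner ℝ θ (A.incr Ψ v s)) ^ 2

/-- The covariance matrix of the increments of `Ψ`. -/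
def covMatrix (Ψ : Γ → EuclideanSpace ℝ (Fin m)) : Matrix (Fin m) (Fin m) ℝ :=
  ∑ v, ∑ s ∈ μ.S, (A.unif * μ.mass s) •
    Matrix.vecMulVec (A.incr Ψ v s).ofLp (A.incr Ψ v s).ofLp

theorem inner_covMatrix (Ψ : Γ → EuclideanSpace ℝ (Fin m)) (x y : EuclideanSpace ℝ (Fin m)) :
    inner ℝ x (WithLp.toLp 2 ((A.covMatrix μ Ψ).mulVec y.ofLp)) =
      ∑ v, ∑ s ∈ μ.S, (A.unif * μ.mass s) *
        (inner ℝ x (A.incr Ψ v s) * inner ℝ y (A.incr Ψ v s)) := by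
  simp only [covMatrix, Matrix.sum_mulVec, WithLp.toLp_sum, inner_sum]
  refine Finset.sum_congr rfl fun v _ => Finset.sum_congr rfl fun s _ => ?_
  simp only [EuclideanSpace.inner_eq_star_dotProduct, star_trivial, Matrix.smul_mulVec,
    Matrix.vecMulVec_mulVec, smul_dotProduct, smul_eq_mul, op_smul_eq_smul]
  rw [dotProduct_comm _ y.ofLp]
  rw [dotProduct_comm y.ofLp]
  ring

theorem inner_covMatrix_self (Ψ : Γ → EuclideanSpace ℝ (Fin m)) (x : EuclideanSpace ℝ (Fin m)) :
    inner ℝ x (WithLp.toLp 2 ((A.covMatrix μ Ψ).mulVec x.ofLp)) = A.variance μ Ψ x := by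
  rw [inner_covMatrix, variance, Finset.mul_sum]
  refine Finset.sum_congr rfl fun v _ => ?_
  rw [Finset.mul_sum]
  exact Finset.sum_congr rfl fun s _ => by ring

theorem exists_basis : ∃ b : Module.Basis (Fin m) ℝ (EuclideanSpace ℝ (Fin m)),
    (∀ j, ∃ g ∈ A.Λ, A.Φ g = b j) ∧
      ∀ g ∈ A.Λ, A.Φ g ∈ Submodule.span ℤ (Set.range b) := by
  obtain ⟨b, hb⟩ := A.lattice
  refine ⟨b, fun j => ?_, fun g hg => ?_⟩
  · have : b j ∈ (Submodule.span ℤ (Set.range b) : Set (EuclideanSpace ℝ (Fin m))) :=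
      Submodule.subset_span ⟨j, rfl⟩
    rw [← hb] at this
    exact this
  · have : A.Φ g ∈ (fun g : Γ => A.ρ g 0) '' (A.Λ : Set Γ) := ⟨g, hg, rfl⟩
    rw [hb] at this
    exact this

variable {A μ} in
-- If $q(x)=0$, then $\langle x,\Psi\rangle$ does not change along any edge, hence is constant
-- because $S$ generates. But $\Lambda$ contains elements that move it by $\langle x,b_j\rangle$, so
-- $x$ is orthogonal to a basis.
theorem Equivariant.posDef_covMatrix {Ψ : Γ → EuclideanSpace ℝ (Fin m)} (hΨ : A.Equivariant Ψ)
    (hgen : Subsemigroup.closure μ.toPMF.support = ⊤) : (A.covMatrix μ Ψ).PosDef := by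
  obtain ⟨b, hb, -⟩ := A.exists_basis
  refine Matrix.PosDef.of_dotProduct_mulVec_pos ?_ fun x hx => ?_
  · rw [Matrix.IsHermitian, Matrix.conjTranspose_eq_transpose_of_trivial, covMatrix]
    simp only [Matrix.transpose_sum, Matrix.transpose_smul, Matrix.transpose_vecMulVec]
  have h0 : star x ⬝ᵥ (A.covMatrix μ Ψ).mulVec x = A.variance μ Ψ (WithLp.toLp 2 x) := by
    rw [← inner_covMatrix_self, EuclideanSpace.inner_eq_star_dotProduct, dotProduct_comm]
  rw [h0]
  have hnn : ∀ v s, 0 ≤ μ.mass s * (inner ℝ (WithLp.toLp 2 x) (A.incr Ψ v s)) ^ 2 :=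
    fun v s => mul_nonneg (μ.mass_nonneg s) (sq_nonneg _)
  have hnn' : ∀ v, 0 ≤ ∑ s ∈ μ.S, μ.mass s * (inner ℝ (WithLp.toLp 2 x) (A.incr Ψ v s)) ^ 2 :=
    fun v => Finset.sum_nonneg fun s _ => hnn v s
  refine mul_pos A.unif_pos ((Finset.sum_nonneg fun v _ => hnn' v).lt_of_ne' fun hzero => hx ?_)
  have h1 : ∀ y : Γ, ∀ s ∈ μ.S, inner ℝ (WithLp.toLp 2 x) (Ψ (y * s)) =
      inner ℝ (WithLp.toLp 2 x) (Ψ y) := by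
    intro y s hs
    rw [Finset.sum_eq_zero_iff_of_nonneg fun v _ => hnn' v] at hzero
    have h2 := hzero (A.coset y) (Finset.mem_univ _)
    rw [Finset.sum_eq_zero_iff_of_nonneg fun s _ => hnn _ s] at h2
    have h3 := h2 s hs
    rw [hΨ.incr_coset, mul_eq_zero, or_iff_right (μ.mass_pos hs).ne', sq_eq_zero_iff,
      inner_sub_right, sub_eq_zero] at h3
    exact h3
  have h2 : ∀ g y : Γ, inner ℝ (WithLp.toLp 2 x) (Ψ (y * g)) =
      inner ℝ (WithLp.toLp 2 x) (Ψ y) := by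
    intro g
    have hg : g ∈ Subsemigroup.closure μ.toPMF.support := hgen ▸ Subsemigroup.mem_top g
    induction hg using Subsemigroup.closure_induction with
    | mem s hs => exact fun y => h1 y s (μ.mem_S.2 hs)
    | mul g k _ _ hg hk => exact fun y => by rw [← mul_assoc, hk, hg]
  have h3 : WithLp.toLp 2 x = (0 : EuclideanSpace ℝ (Fin m)) := by
    refine InnerProductSpace.ext_inner_left_basis b fun j => ?_
    obtain ⟨g, hg, hgb⟩ := hb j
    have h4 := h2 g 1
    rw [one_mul, ← mul_one g, hΨ g hg, inner_add_right, add_eq_right, hgb] at h4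
    rw [inner_zero_right, real_inner_comm, h4]
  exact congrArg WithLp.ofLp h3

/-- The canonical harmonic representative of the embedding `Φ`. -/
theorem exists_harmonicMap : ∃ Ψ : Γ → EuclideanSpace ℝ (Fin m),
    A.Equivariant Ψ ∧ A.HarmonicMap μ Ψ ∧ A.IsCovariance μ (A.covMatrix μ Ψ) ∧
      ∃ B : ℝ, 0 < B ∧ ∀ x, ‖Ψ x - A.Φ x‖ ≤ B := by
  -- The potentials of the coordinate forms are the coordinates of the correction $F$; subtracting
  -- it from $\Phi$ leaves increments equal to the harmonic parts.
  have hf : ∀ j : Fin m, ∃ f : A.Vertex → ℝ,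
      (A.harmonicPart μ (A.hat μ (EuclideanSpace.single j 1)) : A.OneForm μ) + A.d μ f =
        A.hat μ (EuclideanSpace.single j 1) :=
    fun j => (A.harmonicPart_eq_iff μ _ _).1 rfl
  choose f hf using hf
  set F : A.Vertex → EuclideanSpace ℝ (Fin m) := fun v => WithLp.toLp 2 fun j => f j v with hF
  set Ψ : Γ → EuclideanSpace ℝ (Fin m) := fun x => A.Φ x - F (A.coset x) with hΨdef
  have hΨ : A.Equivariant Ψ := fun g hg x => by
    simp only [hΨdef, A.Φ_mul_of_mem hg, A.coset_mul_of_mem hg]; abel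
  have hhat : ∀ w : EuclideanSpace ℝ (Fin m),
      A.hat μ w = ∑ j, w j • A.hat μ (EuclideanSpace.single j 1) := by
    intro w
    ext e
    rw [Submodule.coe_sum, Finset.sum_apply]
    change inner ℝ w (ΦEdge e) = ∑ j, w j * inner ℝ (EuclideanSpace.single j (1 : ℝ)) (ΦEdge e)
    simp [PiLp.inner_apply, mul_comm]
  -- The key identity; both mean-zero increments and the covariance formula are read off from it.
  have hu : ∀ (w : EuclideanSpace ℝ (Fin m)) (e : A.Edge μ),
      ((A.harmonicPart μ (A.hat μ w) : A.OneForm μ) : A.Edge μ → ℝ) e =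
        inner ℝ w (A.incr Ψ e.1 e.2) := by
    intro w e
    have h1 : ∀ j, ((A.harmonicPart μ (A.hat μ (EuclideanSpace.single j 1)) : A.OneForm μ) :
        A.Edge μ → ℝ) e = A.incr Ψ e.1 e.2 j := by
      intro j
      have h2 := congrArg (fun ω : A.OneForm μ => (ω : A.Edge μ → ℝ) e) (hf j)
      simp only [Submodule.coe_add, Pi.add_apply] at h2
      change _ + (f j (term e) - f j (orig e)) =
        inner ℝ (EuclideanSpace.single j (1 : ℝ)) (ΦEdge e) at h2
      rw [EuclideanSpace.inner_single_left] at h2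
      obtain ⟨v, s⟩ := e
      obtain ⟨x, rfl⟩ : ∃ x, A.coset x = v := ⟨_, A.coset_out v⟩
      rw [hΨ.incr_coset]
      rw [ΦEdge_mk] at h2
      simp only [map_one, one_mul, PiLp.sub_apply] at h2
      simp only [hΨdef, hF, PiLp.sub_apply]
      change _ + (f j (A.coset (x * s)) - f j (A.coset x)) = _ at h2
      linarith
    rw [hhat, map_sum, Submodule.coe_sum, Submodule.coe_sum, Finset.sum_apply, PiLp.inner_apply]
    refine Finset.sum_congr rfl fun j _ => ?_
    rw [map_smul]
    change w j * _ = _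
    rw [h1]
    simp [mul_comm]
  refine ⟨Ψ, hΨ, fun v => ?_, fun v₁ v₂ => ?_, ∑ v, ‖F v‖ + 1, by positivity, fun x => ?_⟩
  · refine ext_inner_left ℝ fun w => ?_
    have h1 : A.dStar μ (A.harmonicPart μ (A.hat μ w) : A.OneForm μ) = 0 :=
      LinearMap.mem_ker.1 (A.harmonicPart μ (A.hat μ w)).2
    have h2 := congrFun h1 v
    classical
    have h3 : -∑ e : A.Edge μ with orig e = v, 1 / A.unif * cond e *
        ((A.harmonicPart μ (A.hat μ w) : A.OneForm μ) : A.Edge μ → ℝ) e = 0 := by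
      refine Eq.trans ?_ h2
      change _ = -∑ e : A.Edge μ with orig e = v, _
      congr!
    rw [neg_eq_zero, Finset.sum_filter, Fintype.sum_prod_type] at h3
    simp only [orig] at h3
    rw [Finset.sum_eq_single v (fun v' _ hv' => by simp [hv']) (by simp)] at h3
    simp only [if_true, hu, cond] at h3
    rw [inner_sum, inner_zero_right, ← h3, ← Finset.sum_coe_sort]
    refine Finset.sum_congr rfl fun s _ => ?_
    rw [inner_smul_right]
    field_simp [A.unif_pos.ne']
  · rw [inner_covMatrix, Fintype.sum_prod_type]
    refine Finset.sum_congr rfl fun v _ => ?_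
    rw [← Finset.sum_coe_sort]
    refine Finset.sum_congr rfl fun s _ => ?_
    rw [hu, hu, cond]
    ring
  · simp only [hΨdef]
    rw [sub_sub_cancel_left, norm_neg]
    have := Finset.single_le_sum (f := fun v => ‖F v‖) (fun v _ => norm_nonneg _)
      (Finset.mem_univ (A.coset x))
    linarith

variable (Ψ : Γ → EuclideanSpace ℝ (Fin m))

theorem exists_norm_incr_le : ∃ B : ℝ, 0 < B ∧ ∀ v, ∀ s ∈ μ.S, ‖A.incr Ψ v s‖ ≤ B := by
  refine ⟨∑ v, ∑ s ∈ μ.S, ‖A.incr Ψ v s‖ + 1, by positivity, fun v s hs => ?_⟩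
  have h1 := Finset.single_le_sum (f := fun s => ‖A.incr Ψ v s‖) (fun s _ => norm_nonneg _) hs
  have h2 := Finset.single_le_sum (f := fun v => ∑ s ∈ μ.S, ‖A.incr Ψ v s‖)
    (fun v _ => Finset.sum_nonneg fun s _ => norm_nonneg _) (Finset.mem_univ v)
  linarith

theorem card_mul_unif : (Fintype.card A.Vertex : ℝ) * A.unif = 1 := by
  have hcard : (Fintype.card A.Vertex : ℝ) ≠ 0 := by exact_mod_cast Fintype.card_ne_zero
  rw [unif, mul_one_div_cancel hcard]

theorem norm_le_of_forall_le {h : EuclideanSpace ℂ A.Vertex} {c : ℝ} (hc : 0 ≤ c)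
    (hh : ∀ v, ‖h v‖ ≤ c) : ‖h‖ ≤ √(Fintype.card A.Vertex) * c := by
  refine le_of_sq_le_sq ?_ (by positivity)
  rw [EuclideanSpace.norm_sq_eq, mul_pow, Real.sq_sqrt (by positivity)]
  calc _ ≤ ∑ _v : A.Vertex, c ^ 2 := by
        refine Finset.sum_le_sum fun v _ => ?_
        have := hh v
        gcongr
    _ = _ := by simp

variable {A μ Ψ} in
theorem norm_sum_mass_smul_le {z : Γ → ℂ} {c : ℝ} (hz : ∀ s ∈ μ.S, ‖z s‖ ≤ c) :
    ‖∑ s ∈ μ.S, μ.mass s • z s‖ ≤ c := by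
  calc _ ≤ ∑ s ∈ μ.S, μ.mass s * c := by
        refine norm_sum_le_of_le _ fun s hs => ?_
        rw [norm_smul, Real.norm_of_nonneg (μ.mass_nonneg s)]
        exact mul_le_mul_of_nonneg_left (hz s hs) (μ.mass_nonneg s)
    _ = c := by rw [← Finset.sum_mul, μ.sum_mass, one_mul]

theorem exists_norm_twist_sub_le : ∃ K : ℝ, 0 < K ∧ ∀ θ h,
    ‖A.twist μ Ψ θ h - A.twist μ Ψ 0 h‖ ≤ K * ‖θ‖ * ‖h‖ := by
  obtain ⟨B, hB, hBle⟩ := A.exists_norm_incr_le μ Ψ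
  have hcard : (0 : ℝ) < Fintype.card A.Vertex := by exact_mod_cast Fintype.card_pos
  refine ⟨√(Fintype.card A.Vertex) * B, by positivity, fun θ h => ?_⟩
  refine (A.norm_le_of_forall_le (c := B * ‖θ‖ * ‖h‖) (by positivity) fun v => ?_).trans
    (by apply le_of_eq; ring)
  rw [PiLp.sub_apply, twist_apply, twist_apply, ← Finset.sum_sub_distrib]
  simp_rw [← smul_sub]
  refine norm_sum_mass_smul_le fun s hs => ?_
  rw [inner_zero_left, Complex.ofReal_zero, mul_zero, Complex.exp_zero, ← sub_mul, norm_mul]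
  have h1 : ‖cexp (I * (inner ℝ θ (A.incr Ψ v s) : ℝ)) - 1‖ ≤ B * ‖θ‖ := by
    refine Real.norm_exp_I_mul_ofReal_sub_one_le.trans ((norm_inner_le_norm _ _).trans ?_)
    rw [mul_comm]; gcongr; exact hBle v s hs
  have h2 : ‖h (A.step v s)‖ ≤ ‖h‖ := PiLp.norm_apply_le h _
  gcongr

/-- The constant function one. -/
def oneVec : EuclideanSpace ℂ A.Vertex := WithLp.toLp 2 fun _ => 1

theorem variance_nonneg (θ : EuclideanSpace ℝ (Fin m)) : 0 ≤ A.variance μ Ψ θ :=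
  mul_nonneg A.unif_pos.le (Finset.sum_nonneg fun _ _ => Finset.sum_nonneg fun s _ =>
    mul_nonneg (μ.mass_nonneg s) (sq_nonneg _))

theorem norm_cexp_sub_one_sub_le {x X : ℝ} (hx : |x| ≤ X) :
    ‖cexp (I * x) - 1 - I * x‖ ≤ Real.exp X * |x| ^ 2 := by
  have h := Complex.norm_exp_sub_sum_le_norm_mul_exp (I * x) 2
  have h2 : ‖(I * x : ℂ)‖ = |x| := by simp
  rw [h2] at h
  simp only [Finset.sum_range_succ, Finset.sum_range_zero, zero_add, pow_zero,
    Nat.factorial_zero, Nat.cast_one, div_one, pow_one, Nat.factorial_one] at h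
  rw [← sub_sub] at h
  refine h.trans ?_
  rw [mul_comm]
  gcongr

theorem norm_cexp_sub_quadratic_le {x X : ℝ} (hx : |x| ≤ X) :
    ‖cexp (I * x) - 1 - I * x + (x : ℂ) ^ 2 / 2‖ ≤ Real.exp X * |x| ^ 3 := by
  have h := Complex.norm_exp_sub_sum_le_norm_mul_exp (I * x) 3
  have h2 : ‖(I * x : ℂ)‖ = |x| := by simp
  rw [h2] at h
  have e : cexp (I * x) - ∑ k ∈ Finset.range 3, (I * x : ℂ) ^ k / (k.factorial : ℂ) =
      cexp (I * x) - 1 - I * x + (x : ℂ) ^ 2 / 2 := by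
    simp [Finset.sum_range_succ, Nat.factorial, mul_pow]
    ring
  rw [e] at h
  refine h.trans ?_
  rw [mul_comm]
  gcongr

variable {A μ Ψ} in
/-- The constant function is an approximate eigenvector of the twisted operator. -/
theorem HarmonicMap.exists_twist_one_sub (hh : A.HarmonicMap μ Ψ) (R : ℝ) :
    ∃ C : ℝ, 0 < C ∧ ∀ θ, ‖θ‖ ≤ R → ∃ ζ₀ ζ₁ : EuclideanSpace ℂ A.Vertex,
      A.twist μ Ψ θ A.oneVec - ((Real.exp (-(A.variance μ Ψ θ / 2)) : ℝ) : ℂ) • A.oneVec =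
        ζ₀ + ζ₁ ∧ ∑ v, ζ₀ v = 0 ∧ ‖ζ₀‖ ≤ C * ‖θ‖ ^ 2 ∧ ‖ζ₁‖ ≤ C * ‖θ‖ ^ 3 := by
  obtain ⟨B, hB, hBle⟩ := A.exists_norm_incr_le μ Ψ
  have hcard : (0 : ℝ) < Fintype.card A.Vertex := by exact_mod_cast Fintype.card_pos
  have hcardC : (Fintype.card A.Vertex : ℂ) ≠ 0 := by exact_mod_cast Fintype.card_ne_zero
  have hunif : (A.unif : ℂ) * Fintype.card A.Vertex = 1 := by
    have := A.card_mul_unif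
    rw [mul_comm]; exact_mod_cast this
  set N := √(Fintype.card A.Vertex) with hN
  set R' := |R| with hR'
  set C₂ := Real.exp (B * R') * B ^ 2 + B ^ 2 with hC₂
  set C₃ := Real.exp (B * R') * B ^ 3 + B ^ 4 * R' with hC₃
  refine ⟨N * (C₂ + C₃ * R') + N * C₃ + 1, by positivity, fun θ hθ => ?_⟩
  have hθR : ‖θ‖ ≤ R' := hθ.trans (le_abs_self R)
  set x : A.Vertex → Γ → ℝ := fun v s => inner ℝ θ (A.incr Ψ v s) with hx
  have hxB : ∀ v, ∀ s ∈ μ.S, |x v s| ≤ B * ‖θ‖ := fun v s hs => by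
    refine (abs_real_inner_le_norm _ _).trans ?_
    rw [mul_comm]; gcongr; exact hBle v s hs
  have hxX : ∀ v, ∀ s ∈ μ.S, |x v s| ≤ B * R' := fun v s hs =>
    (hxB v s hs).trans (by gcongr)
  set q := A.variance μ Ψ θ with hq
  have hq0 : 0 ≤ q := A.variance_nonneg μ Ψ θ
  have hqB : q ≤ B ^ 2 * ‖θ‖ ^ 2 := by
    have h1 : ∑ v, ∑ s ∈ μ.S, μ.mass s * (x v s) ^ 2 ≤
        ∑ _v : A.Vertex, ∑ s ∈ μ.S, μ.mass s * (B * ‖θ‖) ^ 2 := by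
      refine Finset.sum_le_sum fun v _ => Finset.sum_le_sum fun s hs => ?_
      refine mul_le_mul_of_nonneg_left ?_ (μ.mass_nonneg s)
      rw [← sq_abs]
      exact pow_le_pow_left₀ (abs_nonneg _) (hxB v s hs) 2
    rw [← Finset.sum_mul, μ.sum_mass, Finset.sum_const, Finset.card_univ, nsmul_eq_mul] at h1
    calc q ≤ A.unif * (Fintype.card A.Vertex * (1 * (B * ‖θ‖) ^ 2)) :=
          mul_le_mul_of_nonneg_left h1 A.unif_pos.le
      _ = (Fintype.card A.Vertex * A.unif) * (B * ‖θ‖) ^ 2 := by ring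
      _ = _ := by rw [A.card_mul_unif]; ring
  set l := Real.exp (-(q / 2)) with hl
  have hl1 : |1 - l| ≤ B ^ 2 * ‖θ‖ ^ 2 := by
    have h1 := Real.add_one_le_exp (-(q / 2))
    have h2 : l ≤ 1 := Real.exp_le_one_iff.2 (by linarith)
    rw [abs_of_nonneg (by linarith)]
    linarith
  have hl2 : |1 - q / 2 - l| ≤ B ^ 4 * R' * ‖θ‖ ^ 3 := by
    have h1 := Real.add_one_le_exp (-(q / 2))
    have h2 : l ≤ 1 - q / 2 + (q / 2) ^ 2 := by
      have h3 := Real.add_one_le_exp (q / 2)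
      have h4 : l * Real.exp (q / 2) = 1 := by rw [hl, ← Real.exp_add]; simp
      have h5 : l * (q / 2 + 1) ≤ 1 := by
        refine le_of_le_of_eq ?_ h4
        exact mul_le_mul_of_nonneg_left h3 (Real.exp_pos _).le
      have h6 : 1 ≤ (1 - q / 2 + (q / 2) ^ 2) * (q / 2 + 1) := by
        nlinarith [pow_nonneg (show 0 ≤ q / 2 by linarith) 3]
      exact le_of_mul_le_mul_right (h5.trans h6) (by linarith)
    have h3 : q ^ 2 ≤ B ^ 4 * R' * ‖θ‖ ^ 3 := by
      calc q ^ 2 ≤ (B ^ 2 * ‖θ‖ ^ 2) ^ 2 := by gcongr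
        _ = B ^ 4 * ‖θ‖ * ‖θ‖ ^ 3 := by ring
        _ ≤ _ := by gcongr
    rw [abs_sub_comm, abs_of_nonneg (by linarith)]
    nlinarith
  set ζ := A.twist μ Ψ θ A.oneVec - ((l : ℝ) : ℂ) • A.oneVec with hζ
  have hζv : ∀ v, ζ v = ∑ s ∈ μ.S, μ.mass s • (cexp (I * x v s) - 1 - I * x v s) +
      ((1 - l : ℝ) : ℂ) := by
    intro v
    -- Harmonicity of $\Psi$ kills the first-order term at every vertex, so the defect is
    -- $O(|\theta|^2)$ pointwise.
    have h0 : ∑ s ∈ μ.S, μ.mass s • (I * x v s : ℂ) = 0 := by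
      have h1 := congrArg (fun y => inner ℝ θ y) (hh v)
      simp only [inner_sum, inner_smul_right, inner_zero_right] at h1
      have h2 : ∑ s ∈ μ.S, μ.mass s • (I * x v s : ℂ) =
          I * ((∑ s ∈ μ.S, μ.mass s * x v s : ℝ) : ℂ) := by
        push_cast
        rw [Finset.mul_sum]
        refine Finset.sum_congr rfl fun s _ => ?_
        rw [Complex.real_smul]; ring
      rw [h2, h1]; simp
    have h00 : ∑ s ∈ μ.S, μ.mass s • (1 : ℂ) = 1 := by
      rw [← Finset.sum_smul, μ.sum_mass, one_smul]
    simp only [smul_sub, Finset.sum_sub_distrib]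
    rw [h0, h00]
    rw [hζ, PiLp.sub_apply, PiLp.smul_apply, twist_apply]
    simp only [oneVec, mul_one, smul_eq_mul]
    push_cast
    ring
  have hζle : ∀ v, ‖ζ v‖ ≤ C₂ * ‖θ‖ ^ 2 := by
    intro v
    rw [hζv]
    have h1 : ‖∑ s ∈ μ.S, μ.mass s • (cexp (I * x v s) - 1 - I * x v s)‖ ≤
        Real.exp (B * R') * (B * ‖θ‖) ^ 2 :=
      norm_sum_mass_smul_le fun s hs => (norm_cexp_sub_one_sub_le (hxX v s hs)).trans (by
        have := hxB v s hs
        gcongr)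
    refine (norm_add_le _ _).trans ?_
    rw [Complex.norm_real, Real.norm_eq_abs]
    calc _ ≤ Real.exp (B * R') * (B * ‖θ‖) ^ 2 + B ^ 2 * ‖θ‖ ^ 2 := add_le_add h1 hl1
      _ = _ := by ring
  set a : ℂ := A.unif * ∑ v, ζ v with ha
  -- Only after averaging over the vertices does the second-order term equal $-q/2$ and cancel
  -- against $e^{-q/2}$; the average of the defect is therefore $O(|\theta|^3)$.
  have haeq : a = A.unif * ∑ v, ∑ s ∈ μ.S, μ.mass s •
      (cexp (I * x v s) - 1 - I * x v s + (x v s : ℂ) ^ 2 / 2) + ((1 - q / 2 - l : ℝ) : ℂ) := by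
    have h1 : ((q / 2 : ℝ) : ℂ) =
        A.unif * ∑ v, ∑ s ∈ μ.S, μ.mass s • ((x v s : ℂ) ^ 2 / 2) := by
      rw [hq, variance]
      push_cast
      rw [mul_div_assoc, Finset.sum_div]
      congr 1
      refine Finset.sum_congr rfl fun v _ => ?_
      rw [Finset.sum_div]
      refine Finset.sum_congr rfl fun s _ => ?_
      rw [Complex.real_smul]; ring
    simp only [smul_add, Finset.sum_add_distrib, mul_add]
    rw [← h1, ha]
    simp_rw [hζv]
    rw [Finset.sum_add_distrib, Finset.sum_const, Finset.card_univ, nsmul_eq_mul, mul_add,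
      ← mul_assoc, hunif]
    push_cast
    ring
  have hale : ‖a‖ ≤ C₃ * ‖θ‖ ^ 3 := by
    rw [haeq]
    refine (norm_add_le _ _).trans ?_
    rw [norm_mul, Complex.norm_real, Complex.norm_real, Real.norm_of_nonneg A.unif_pos.le,
      Real.norm_eq_abs]
    have h1 : ‖∑ v, ∑ s ∈ μ.S, μ.mass s •
      (cexp (I * x v s) - 1 - I * x v s + (x v s : ℂ) ^ 2 / 2)‖ ≤
        ∑ _v : A.Vertex, Real.exp (B * R') * (B * ‖θ‖) ^ 3 := by
      refine norm_sum_le_of_le _ fun v _ => norm_sum_mass_smul_le fun s hs =>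
        (norm_cexp_sub_quadratic_le (hxX v s hs)).trans ?_
      have := hxB v s hs
      gcongr
    rw [Finset.sum_const, Finset.card_univ, nsmul_eq_mul] at h1
    calc _ ≤ A.unif * (Fintype.card A.Vertex * (Real.exp (B * R') * (B * ‖θ‖) ^ 3)) +
          B ^ 4 * R' * ‖θ‖ ^ 3 := add_le_add (mul_le_mul_of_nonneg_left h1 A.unif_pos.le) hl2
      _ = (Fintype.card A.Vertex * A.unif) * (Real.exp (B * R') * (B * ‖θ‖) ^ 3) +
          B ^ 4 * R' * ‖θ‖ ^ 3 := by ring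
      _ = _ := by rw [A.card_mul_unif]; ring
  have hζ1 : ‖a • A.oneVec‖ ≤ N * (C₃ * ‖θ‖ ^ 3) :=
    A.norm_le_of_forall_le (by positivity) fun v => by
      rw [PiLp.smul_apply]; simpa [oneVec] using hale
  -- Split the defect into its mean-zero part, where $T_0$ contracts, and its mean.
  refine ⟨ζ - a • A.oneVec, a • A.oneVec, by abel, ?_, ?_, hζ1.trans ?_⟩
  · simp only [PiLp.sub_apply, PiLp.smul_apply, oneVec, smul_eq_mul, mul_one,
      Finset.sum_sub_distrib, Finset.sum_const, Finset.card_univ, nsmul_eq_mul]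
    rw [ha, ← mul_assoc, mul_comm _ (A.unif : ℂ), hunif, one_mul, sub_self]
  · refine (norm_sub_le _ _).trans ?_
    have h1 : ‖ζ‖ ≤ N * (C₂ * ‖θ‖ ^ 2) := A.norm_le_of_forall_le (by positivity) hζle
    calc _ ≤ N * (C₂ * ‖θ‖ ^ 2) + N * (C₃ * ‖θ‖ ^ 3) := add_le_add h1 hζ1
      _ = N * (C₂ * ‖θ‖ ^ 2) + N * (C₃ * ‖θ‖ * ‖θ‖ ^ 2) := by ring
      _ ≤ N * (C₂ * ‖θ‖ ^ 2) + N * (C₃ * R' * ‖θ‖ ^ 2) := by gcongr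
      _ ≤ N * (C₂ * ‖θ‖ ^ 2) + N * (C₃ * R' * ‖θ‖ ^ 2) + (N * C₃ + 1) * ‖θ‖ ^ 2 :=
        le_add_of_nonneg_right (by positivity)
      _ = _ := by ring
  · calc _ ≤ N * (C₃ * ‖θ‖ ^ 3) + (N * (C₂ + C₃ * R') + 1) * ‖θ‖ ^ 3 :=
        le_add_of_nonneg_right (by positivity)
      _ = _ := by ring

end LatticeAction

/-! ### The law of the walk as a finitely supported function -/

namespace SymmetricLaw

variable {Γ : Type*} [Group Γ] (μ : SymmetricLaw Γ)

/-- The law of the walk after `n` steps as a finitely supported function. -/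
def law : ℕ → (Γ →₀ ℝ)
  | 0 => Finsupp.single 1 1
  | n + 1 => ∑ s ∈ μ.S, μ.mass s • (law n).mapDomain (· * s)

theorem law_succ_apply (n : ℕ) (x : Γ) :
    μ.law (n + 1) x = ∑ s ∈ μ.S, μ.mass s * μ.law n (x * s⁻¹) := by
  rw [law, Finsupp.finsetSum_apply]
  refine Finset.sum_congr rfl fun s _ => ?_
  rw [Finsupp.smul_apply, smul_eq_mul]
  conv_lhs => rw [← inv_mul_cancel_right x s]
  rw [Finsupp.mapDomain_apply (mul_left_injective s)]

theorem toReal_convPow (n : ℕ) (x : Γ) : (convPow μ.toPMF n x).toReal = μ.law n x := by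
  classical
  induction n generalizing x with
  | zero =>
    by_cases h : x = 1
    · simp [convPow, law, h]
    · simp [convPow, law, h]
  | succ n ih =>
    have hmap : ∀ s, (convPow μ.toPMF n).map (· * s) x = convPow μ.toPMF n (x * s⁻¹) := by
      intro s
      rw [PMF.map_apply, tsum_eq_single (x * s⁻¹) fun y hy => ?_]
      · simp
      · rw [if_neg]
        rintro rfl
        simp at hy
    have hcomm : convPow μ.toPMF (n + 1) =
        μ.toPMF.bind fun s => (convPow μ.toPMF n).map (· * s) := by
      simp only [convPow, PMF.map]
      rw [PMF.bind_comm]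
      rfl
    rw [hcomm, PMF.bind_apply, tsum_eq_sum (s := μ.S) fun s hs => ?_, ENNReal.toReal_sum,
      law_succ_apply]
    · refine Finset.sum_congr rfl fun s _ => ?_
      rw [ENNReal.toReal_mul, hmap, ih, mass]
    · exact fun s _ => ENNReal.mul_ne_top (PMF.apply_ne_top _ _) (PMF.apply_ne_top _ _)
    · rw [mem_S, PMF.mem_support_iff, not_not] at hs
      rw [hs, zero_mul]

theorem law_nonneg (n : ℕ) (x : Γ) : 0 ≤ μ.law n x := by
  rw [← toReal_convPow]; exact ENNReal.toReal_nonneg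

/-- Duality: the last step of the walk is moved onto the test function as the transition operator.
-/
theorem linearCombination_law_succ {F : Type*} [AddCommGroup F] [Module ℝ F] (n : ℕ) (f : Γ → F) :
    Finsupp.linearCombination ℝ f (μ.law (n + 1)) =
      Finsupp.linearCombination ℝ (fun x => ∑ s ∈ μ.S, μ.mass s • f (x * s)) (μ.law n) := by
  rw [law, map_sum]
  simp only [map_smul, Finsupp.linearCombination_mapDomain]
  simp only [Finsupp.linearCombination_apply, Finsupp.sum, Finset.smul_sum, Function.comp_apply]
  rw [Finset.sum_comm]
  exact Finset.sum_congr rfl fun x _ => Finset.sum_congr rfl fun s _ => smul_comm _ _ _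

end SymmetricLaw

/-! ### Powers of the twisted operator and Fourier inversion -/

namespace LatticeAction

variable {Γ : Type*} [Group Γ] {m : ℕ} {A : LatticeAction Γ m} {μ : SymmetricLaw Γ}
  {Ψ : Γ → EuclideanSpace ℝ (Fin m)}

instance decidableEqVertex : DecidableEq A.Vertex := Classical.decEq _

variable (A) in
-- Isometries carry a ball inside the interior of the fundamental domain to balls inside disjoint
-- translates. This gives the injectivity of $\Phi$ and bounds sums over the orbit by integrals.
theorem exists_disjoint_ball : ∃ r : ℝ, 0 < r ∧ ∀ x y : Γ, x ≠ y →
    Disjoint (Metric.ball (A.Φ x) r) (Metric.ball (A.Φ y) r) := by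
  obtain ⟨F, hF, h0⟩ := A.exists_fundamentalDomain
  obtain ⟨r, hr, hball⟩ := Metric.isOpen_iff.1 isOpen_interior 0 h0
  refine ⟨r, hr, fun x y hxy => ?_⟩
  have := hF.disjoint_interior x y hxy
  have h : ∀ x, Metric.ball (A.Φ x) r ⊆ A.ρ x '' interior F := fun x => by
    have := Set.image_mono (f := A.ρ x) hball
    rwa [IsometryEquiv.image_ball] at this
  exact this.mono (h x) (h y)

variable (A) in
theorem Φ_injective : Function.Injective A.Φ := by
  obtain ⟨r, hr, h⟩ := A.exists_disjoint_ball
  intro x y hxy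
  by_contra hne
  have := h x y hne
  rw [hxy, disjoint_self] at this
  exact (Metric.nonempty_ball.2 hr).ne_empty this

/-- The Gaussian approximation of the powers of the twisted operator. -/
theorem Equivariant.exists_norm_twist_pow_sub_le (hΨ : A.Equivariant Ψ) (hh : A.HarmonicMap μ Ψ)
    (hgen : Subsemigroup.closure μ.toPMF.support = ⊤) (h1 : (1 : Γ) ∈ μ.S)
    {b : Module.Basis (Fin m) ℝ (EuclideanSpace ℝ (Fin m))}
    (hb : ∀ j, ∃ g ∈ A.Λ, A.Φ g = b j) {c₁ : ℝ} (hc₁ : 0 < c₁)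
    (hvar : ∀ θ, c₁ * ‖θ‖ ^ 2 ≤ A.variance μ Ψ θ) :
    ∃ C c : ℝ, 0 < C ∧ 0 < c ∧ c ≤ c₁ / 4 ∧ ∀ n : ℕ, 1 ≤ n → ∀ θ ∈ dualCell b,
      ∀ u v : A.Vertex,
      ‖(A.twist μ Ψ θ ^ n) (EuclideanSpace.single v 1) u -
        ((A.unif * Real.exp (-(n * A.variance μ Ψ θ / 2)) : ℝ) : ℂ)‖ ≤
        C / √n * Real.exp (-(c * n * ‖θ‖ ^ 2)) := by
  obtain ⟨c₀, hc₀, hgap⟩ := hΨ.exists_norm_twist_le hgen h1 hb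
  obtain ⟨ρ₀, hρ₀, hρ₁, hzero⟩ := hΨ.exists_norm_twist_zero_pow_le hgen h1
  obtain ⟨R, hR, hRle⟩ := exists_norm_le_of_mem_dualCell b
  obtain ⟨K, hK, hKle⟩ := A.exists_norm_twist_sub_le μ Ψ
  obtain ⟨Z, hZ, hZle⟩ := hh.exists_twist_one_sub R
  -- The contraction rate $\rho_0=\rho\cdot\rho$ is split: one factor is bounded by $\gamma$ on the
  -- cell, leaving the other as the margin needed in the perturbation lemmas.
  set ρ := √ρ₀ with hρ
  have hρpos : 0 < ρ := Real.sqrt_pos.2 hρ₀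
  have hρlt : ρ < 1 := by rw [hρ, Real.sqrt_lt' one_pos]; simpa using hρ₁
  have hρsq : ρ * ρ = ρ₀ := Real.mul_self_sqrt hρ₀.le
  have hlog : 0 < -Real.log ρ := by linarith [Real.log_neg hρpos hρlt]
  -- The three bounds give, in turn, $\|T_\theta\|\le\gamma$, $e^{-q/2}\le\gamma$, and
  -- $\rho\le\gamma$ on the cell, with $\gamma=e^{-a|\theta|^2}$.
  set a := min (min c₀ (c₁ / 2)) (-Real.log ρ / R ^ 2) with ha
  have hapos : 0 < a := by simp only [ha, lt_min_iff]; exact ⟨⟨hc₀, by positivity⟩, by positivity⟩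
  obtain ⟨P₁, hP₁, hP₁le⟩ := exists_pow_mul_exp_neg_le 1 (half_pos hapos)
  obtain ⟨P₃, hP₃, hP₃le⟩ := exists_pow_mul_exp_neg_le 3 (half_pos hapos)
  obtain ⟨D, hD, hDle⟩ := exists_pow_le_div_sqrt hρpos.le hρlt
  have h1ρ : 0 < 1 - ρ := by linarith
  set E := K / (ρ * (1 - ρ)) with hE
  set N := ‖A.oneVec‖ with hN
  have hEpos : 0 < E := by positivity
  have huP := A.unif_pos
  set C₁ := A.unif * ρ⁻¹ * Z * R / (1 - ρ) + (1 + A.unif * N) * E with hC₁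
  set C₃ := A.unif * ρ⁻¹ * (E * Z + Z) with hC₃
  have hC₁pos : 0 < C₁ := by positivity
  refine ⟨C₁ * P₁ + C₃ * P₃ + (1 + A.unif * N) * D, a / 2, by positivity, by positivity,
    ?_, fun n hn θ hθ u v => ?_⟩
  · have : a ≤ c₁ / 2 := (min_le_left _ _).trans (min_le_right _ _)
    linarith
  have hnpos : (0 : ℝ) < n := by exact_mod_cast hn
  have hθR := hRle θ hθ
  set γ := Real.exp (-(a * ‖θ‖ ^ 2)) with hγ
  have hγpos : 0 < γ := Real.exp_pos _
  have hργ : ρ ≤ γ := by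
    rw [hγ, ← Real.log_le_iff_le_exp hρpos]
    have h2 : a ≤ -Real.log ρ / R ^ 2 := min_le_right _ _
    rw [le_div_iff₀ (by positivity)] at h2
    have h3 : a * ‖θ‖ ^ 2 ≤ a * R ^ 2 := by gcongr
    linarith
  have hγinv : γ⁻¹ ≤ ρ⁻¹ := inv_anti₀ hρpos hργ
  have hT : ∀ h, ‖A.twist μ Ψ θ h‖ ≤ γ * ‖h‖ := fun h => by
    refine (hgap θ hθ h).trans ?_
    have : a ≤ c₀ := (min_le_left _ _).trans (min_le_left _ _)
    rw [hγ]
    gcongr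
  have hr : ∀ h : EuclideanSpace ℂ A.Vertex, ∑ v, h v = 0 →
      ∀ k, ‖(A.twist μ Ψ 0 ^ k) h‖ ≤ (ρ * γ) ^ k * ‖h‖ := fun h h0 k => by
    refine (hzero h h0 k).trans ?_
    rw [← hρsq]
    gcongr
  have hd := hKle θ
  have hε : 0 ≤ K * ‖θ‖ := by positivity
  set l := Real.exp (-(A.variance μ Ψ θ / 2)) with hl
  have hlγ : l ≤ γ := by
    have h2 : a ≤ c₁ / 2 := (min_le_left _ _).trans (min_le_right _ _)
    refine Real.exp_le_exp.2 (neg_le_neg ?_)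
    have := hvar θ
    nlinarith [sq_nonneg ‖θ‖]
  have hEθ : K * ‖θ‖ / (γ * (1 - ρ)) ≤ E * ‖θ‖ := by
    rw [hE, div_mul_eq_mul_div]; gcongr
  obtain ⟨ζ₀, ζ₁, hζ, hζ0, hζ₀, hζ₁⟩ := hZle θ hθR
  have hone := norm_pow_apply_sub_le hγpos hρpos.le hρlt hε hT hd (Real.exp_pos _).le hlγ hζ
    (hr ζ₀ hζ0) n
  -- The point mass at $v$ is its mean, treated as an approximate eigenvector, plus a mean-zero
  -- vector $r$.
  set r : EuclideanSpace ℂ A.Vertex := EuclideanSpace.single v 1 - (A.unif : ℂ) • A.oneVec with hrdef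
  have hr0 : ∑ w, r w = 0 := by
    have hunif : (Fintype.card A.Vertex : ℂ) * A.unif = 1 := by
      have := A.card_mul_unif
      exact_mod_cast this
    simp [hrdef, oneVec, Finset.sum_sub_distrib, hunif]
  have hrN : ‖r‖ ≤ 1 + A.unif * N := by
    refine (norm_sub_le _ _).trans ?_
    rw [norm_smul, Complex.norm_real, Real.norm_of_nonneg huP.le, hN]
    simp
  have hrn := norm_pow_apply_le_of_near hγpos hρpos.le hρlt hε hT hd (hr r hr0) n
  have hγn : γ ^ n = Real.exp (-(a * n * ‖θ‖ ^ 2)) := by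
    rw [hγ, ← Real.exp_nat_mul]; congr 1; ring
  have hln : l ^ n = Real.exp (-(n * A.variance μ Ψ θ / 2)) := by
    rw [hl, ← Real.exp_nat_mul]; congr 1; ring
  have hdecomp : (A.twist μ Ψ θ ^ n) (EuclideanSpace.single v 1) u - ((A.unif * l ^ n : ℝ) : ℂ) =
      ((A.unif : ℂ) • ((A.twist μ Ψ θ ^ n) A.oneVec - ((l ^ n : ℝ) : ℂ) • A.oneVec) +
        (A.twist μ Ψ θ ^ n) r) u := by
    have : EuclideanSpace.single v (1 : ℂ) = (A.unif : ℂ) • A.oneVec + r := by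
      rw [hrdef]; abel
    rw [this, map_add, map_smul]
    simp only [PiLp.add_apply, PiLp.smul_apply, PiLp.sub_apply, smul_eq_mul, oneVec]
    push_cast
    ring
  rw [← hln, hdecomp]
  have hbound : A.unif * (γ ^ n * γ⁻¹ * (‖ζ₀‖ / (1 - ρ) +
      n * (K * ‖θ‖ / (γ * (1 - ρ)) * ‖ζ₀‖ + ‖ζ₁‖))) +
      γ ^ n * (ρ ^ n + K * ‖θ‖ / (γ * (1 - ρ))) * ‖r‖ ≤
      γ ^ n * (C₁ * ‖θ‖ + C₃ * (n * ‖θ‖ ^ 3) + (1 + A.unif * N) * ρ ^ n) := by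
    have hζ₀R : ‖ζ₀‖ ≤ Z * R * ‖θ‖ := hζ₀.trans (by
      rw [mul_assoc, sq]; gcongr)
    calc _ ≤ A.unif * (γ ^ n * ρ⁻¹ * (Z * R * ‖θ‖ / (1 - ρ) +
      n * (E * ‖θ‖ * (Z * ‖θ‖ ^ 2) + Z * ‖θ‖ ^ 3))) +
      γ ^ n * (ρ ^ n + E * ‖θ‖) * (1 + A.unif * N) := by gcongr
      _ = _ := by rw [hC₁, hC₃]; ring
  refine (PiLp.norm_apply_le _ u).trans ((norm_add_le _ _).trans ?_)
  rw [norm_smul, Complex.norm_real, Real.norm_of_nonneg huP.le]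
  refine (add_le_add (mul_le_mul_of_nonneg_left hone huP.le) hrn).trans (hbound.trans ?_)
  have hs : 0 < √(n : ℝ) := Real.sqrt_pos.2 hnpos
  have hsq : √(n : ℝ) ^ 2 = n := Real.sq_sqrt hnpos.le
  -- Half of the Gaussian factor is spent on turning $|\theta|$ and $n|\theta|^3$ into
  -- $O(n^{-1/2})$; the other half is kept for the integration over $\theta$.
  have hsplit : γ ^ n = Real.exp (-(a / 2 * (√n * ‖θ‖) ^ 2)) *
      Real.exp (-(a / 2 * n * ‖θ‖ ^ 2)) := by
    rw [hγn, ← Real.exp_add, mul_pow, hsq]; congr 1; ring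
  set G := Real.exp (-(a / 2 * (√n * ‖θ‖) ^ 2)) with hG
  have hG1 : G ≤ 1 := Real.exp_le_one_iff.2 (by
    have : 0 ≤ a / 2 * (√n * ‖θ‖) ^ 2 := by positivity
    linarith)
  have e1 : ‖θ‖ * G ≤ P₁ / √n := by
    rw [le_div_iff₀ hs]
    have := hP₁le (√n * ‖θ‖) (by positivity)
    calc _ = (√n * ‖θ‖) ^ 1 * G := by ring
      _ ≤ _ := this
  have e3 : n * ‖θ‖ ^ 3 * G ≤ P₃ / √n := by
    rw [le_div_iff₀ hs]
    have := hP₃le (√n * ‖θ‖) (by positivity)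
    calc _ = (√n * ‖θ‖) ^ 3 * G := by rw [mul_pow, pow_succ √(n : ℝ) 2, hsq]; ring
      _ ≤ _ := this
  have eD : ρ ^ n * G ≤ D / √n :=
    (mul_le_of_le_one_right (by positivity) hG1).trans (hDle n hn)
  rw [hsplit]
  calc _ = (C₁ * (‖θ‖ * G) + C₃ * (n * ‖θ‖ ^ 3 * G) + (1 + A.unif * N) * (ρ ^ n * G)) *
        Real.exp (-(a / 2 * n * ‖θ‖ ^ 2)) := by ring
    _ ≤ (C₁ * (P₁ / √n) + C₃ * (P₃ / √n) + (1 + A.unif * N) * (D / √n)) *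
        Real.exp (-(a / 2 * n * ‖θ‖ ^ 2)) := by gcongr
    _ = _ := by ring

/-- The lift intertwines $T_\theta$ on $V$ with the transition operator on $\Gamma$, so $T_\theta^n$
computes twisted expectations of the walk at time $n$. -/
theorem Equivariant.linearCombination_lift (hΨ : A.Equivariant Ψ) (θ : EuclideanSpace ℝ (Fin m))
    (n : ℕ) (h : EuclideanSpace ℂ A.Vertex) :
    Finsupp.linearCombination ℝ (A.lift Ψ θ h) (μ.law n) =
      cexp (I * (inner ℝ θ (Ψ 1) : ℝ)) * (A.twist μ Ψ θ ^ n) h (A.coset 1) := by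
  induction n generalizing h with
  | zero => simp [SymmetricLaw.law, lift]
  | succ n ih =>
    rw [μ.linearCombination_law_succ, pow_succ, Module.End.mul_apply, ← ih]
    congr 2
    ext x
    rw [lift, twist_apply, Finset.mul_sum]
    refine Finset.sum_congr rfl fun s _ => ?_
    rw [hΨ.lift_mul, mul_smul_comm]

/-- The integrand of the Fourier inversion formula as a trigonometric polynomial. -/
theorem Equivariant.cexp_mul_twist_pow (hΨ : A.Equivariant Ψ) (θ : EuclideanSpace ℝ (Fin m))
    (n : ℕ) (x : Γ) :
    cexp (-(I * (inner ℝ θ (Ψ x - Ψ 1) : ℝ))) *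
      (A.twist μ Ψ θ ^ n) (EuclideanSpace.single (A.coset x) 1) (A.coset 1) =
    ∑ y ∈ (μ.law n).support, (μ.law n y : ℂ) *
      ((EuclideanSpace.single (A.coset x) (1 : ℂ) : EuclideanSpace ℂ A.Vertex) (A.coset y) *
        cexp (I * (inner ℝ θ (Ψ y - Ψ x) : ℝ))) := by
  have h1 := hΨ.linearCombination_lift (μ := μ) θ n (EuclideanSpace.single (A.coset x) 1)
  have h2 : (A.twist μ Ψ θ ^ n) (EuclideanSpace.single (A.coset x) 1) (A.coset 1) =
      cexp (-(I * (inner ℝ θ (Ψ 1) : ℝ))) *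
        Finsupp.linearCombination ℝ (A.lift Ψ θ (EuclideanSpace.single (A.coset x) 1))
          (μ.law n) := by
    rw [h1, ← mul_assoc, ← Complex.exp_add]; simp
  rw [h2, Finsupp.linearCombination_apply, Finsupp.sum, Finset.mul_sum, Finset.mul_sum]
  refine Finset.sum_congr rfl fun y _ => ?_
  have h3 : cexp (I * (inner ℝ θ (Ψ y - Ψ x) : ℝ)) = cexp (-(I * (inner ℝ θ (Ψ x - Ψ 1) : ℝ))) *
      cexp (-(I * (inner ℝ θ (Ψ 1) : ℝ))) * cexp (I * (inner ℝ θ (Ψ y) : ℝ)) := by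
    rw [← Complex.exp_add, ← Complex.exp_add, inner_sub_right, inner_sub_right]
    congr 1
    push_cast
    ring
  rw [h3, lift, Complex.real_smul]
  ring

/-- Fourier inversion for the law of the walk. -/
theorem Equivariant.integral_twist_pow (hΨ : A.Equivariant Ψ)
    {b : Module.Basis (Fin m) ℝ (EuclideanSpace ℝ (Fin m))}
    (hbΛ : ∀ g ∈ A.Λ, A.Φ g ∈ Submodule.span ℤ (Set.range b)) {κ : ℝ}
    (hκ : ∀ y ∈ Submodule.span ℤ (Set.range b),
      ∫ θ in dualCell b, cexp (I * (inner ℝ θ y : ℝ)) = if y = 0 then (κ : ℂ) else 0)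
    (n : ℕ) (x : Γ) :
    IntegrableOn (fun θ => cexp (-(I * (inner ℝ θ (Ψ x - Ψ 1) : ℝ))) *
      (A.twist μ Ψ θ ^ n) (EuclideanSpace.single (A.coset x) 1) (A.coset 1)) (dualCell b) ∧
    ∫ θ in dualCell b, cexp (-(I * (inner ℝ θ (Ψ x - Ψ 1) : ℝ))) *
      (A.twist μ Ψ θ ^ n) (EuclideanSpace.single (A.coset x) 1) (A.coset 1) = κ * μ.law n x := by
  classical
  obtain ⟨R, hR, hRle⟩ := exists_norm_le_of_mem_dualCell b
  have hcompact : IsCompact (dualCell b) :=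
    (isCompact_closedBall (0 : EuclideanSpace ℝ (Fin m)) R).of_isClosed_subset
      (isClosed_dualCell b) fun θ hθ => by simpa using hRle θ hθ
  have hint : ∀ y ∈ (μ.law n).support, IntegrableOn (fun θ => (μ.law n y : ℂ) *
      ((EuclideanSpace.single (A.coset x) (1 : ℂ) : EuclideanSpace ℂ A.Vertex) (A.coset y) *
        cexp (I * (inner ℝ θ (Ψ y - Ψ x) : ℝ)))) (dualCell b) := fun y _ => by
    refine ContinuousOn.integrableOn_compact hcompact (Continuous.continuousOn ?_)
    fun_prop
  simp_rw [hΨ.cexp_mul_twist_pow]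
  refine ⟨integrable_finsetSum _ hint, ?_⟩
  rw [integral_finsetSum _ hint]
  have hterm : ∀ y, ∫ θ in dualCell b, (μ.law n y : ℂ) *
      ((EuclideanSpace.single (A.coset x) (1 : ℂ) : EuclideanSpace ℂ A.Vertex) (A.coset y) *
        cexp (I * (inner ℝ θ (Ψ y - Ψ x) : ℝ))) = if y = x then (κ : ℂ) * μ.law n x else 0 := by
    intro y
    rw [integral_const_mul, integral_const_mul]
    -- The point mass selects $y\in\Lambda x$; then $\Psi(y)-\Psi(x)$ is a lattice vector, and
    -- orthogonality of characters leaves only $y=x$, by injectivity of $\Phi$.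
    by_cases hxy : A.coset x = A.coset y
    · have hg : y * x⁻¹ ∈ A.Λ := A.coset_eq.1 hxy
      have e1 : Ψ y - Ψ x = A.Φ (y * x⁻¹) := by
        have := hΨ _ hg x
        rw [inv_mul_cancel_right] at this
        rw [this]; abel
      have e2 : A.Φ (y * x⁻¹) = 0 ↔ y = x := by
        have h0 : A.Φ 1 = 0 := by simp [Φ]
        rw [← h0, A.Φ_injective.eq_iff, mul_inv_eq_one]
      rw [e1, hκ _ (hbΛ _ hg)]
      split_ifs with h h' h'
      · subst h'; simp; ring
      · exact absurd (e2.1 h) h'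
      · exact absurd (e2.2 h') h
      · simp
    · have hne : y ≠ x := fun h => hxy (by rw [h])
      rw [if_neg hne]
      have : (EuclideanSpace.single (A.coset x) (1 : ℂ) : EuclideanSpace ℂ A.Vertex)
          (A.coset y) = 0 := by
        rw [PiLp.single_apply, if_neg (Ne.symm hxy)]
      rw [this]; simp
  simp_rw [hterm]
  rw [Finset.sum_ite_eq']
  split_ifs with h
  · rfl
  · rw [Finsupp.notMem_support_iff.1 h]; simp

end LatticeAction

/-! ### The local limit theorem, exponential moments and Gaussian sums -/

namespace LatticeAction

variable {Γ : Type*} [Group Γ] {m : ℕ} {A : LatticeAction Γ m} {μ : SymmetricLaw Γ}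
  {Ψ : Γ → EuclideanSpace ℝ (Fin m)}

variable (A) in
theorem exists_ξ_smul_eq {M : Matrix (Fin m) (Fin m) ℝ} (hM : M.PosDef)
    {N : EuclideanSpace ℝ (Fin m) ≃L[ℝ] EuclideanSpace ℝ (Fin m)}
    (hN : ∀ y, inner ℝ y (WithLp.toLp 2 (M⁻¹.mulVec y.ofLp)) = ‖N y‖ ^ 2) :
    ∃ κ : ℝ, 0 < κ ∧ ∀ n : ℕ, 1 ≤ n → ∀ x, A.ξ ((n : ℝ) • M) x =
      κ * (n : ℝ) ^ (-((m : ℝ) / 2)) * Real.exp (-(‖N (A.Φ x)‖ ^ 2 / (2 * n))) := by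
  have hdet := hM.det_pos
  have hpi := Real.pi_pos
  refine ⟨1 / ((2 * Real.pi) ^ ((m : ℝ) / 2) * √M.det), by positivity, fun n hn x => ?_⟩
  have hn0 : (0 : ℝ) < n := by exact_mod_cast hn
  have hinv : ((n : ℝ) • M)⁻¹ = (n : ℝ)⁻¹ • M⁻¹ := by
    have := Matrix.inv_smul' M (Units.mk0 (n : ℝ) hn0.ne') hdet.ne'.isUnit
    rwa [Units.smul_def, Units.smul_def, Units.val_inv_eq_inv_val] at this
  have hsqrt : √((n : ℝ) • M).det = (n : ℝ) ^ ((m : ℝ) / 2) * √M.det := by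
    rw [Matrix.det_smul, Fintype.card_fin, Real.sqrt_mul (by positivity)]
    congr 1
    rw [← Real.rpow_natCast, Real.sqrt_eq_rpow, ← Real.rpow_mul hn0.le]
    congr 1; ring
  rw [ξ, hinv, hsqrt, Matrix.smul_mulVec, WithLp.toLp_smul, inner_smul_right, hN,
    Real.rpow_neg hn0.le]
  congr 1
  · field_simp
  · congr 1; field_simp

theorem exists_mul_norm_sq_le (L : EuclideanSpace ℝ (Fin m) ≃L[ℝ] EuclideanSpace ℝ (Fin m)) :
    ∃ c : ℝ, 0 < c ∧ ∀ y, c * ‖y‖ ^ 2 ≤ ‖L y‖ ^ 2 := by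
  obtain ⟨K, hK, h⟩ := L.symm.toContinuousLinearMap.bound
  refine ⟨(K ^ 2)⁻¹, by positivity, fun y => ?_⟩
  have h1 : ‖y‖ ≤ K * ‖L y‖ := by simpa using h (L y)
  rw [inv_mul_le_iff₀ (by positivity), ← mul_pow]
  gcongr

theorem integrable_gaussian {c : ℝ} (hc : 0 < c) :
    Integrable fun θ : EuclideanSpace ℝ (Fin m) => Real.exp (-(c * ‖θ‖ ^ 2)) := by
  have h := (GaussianFourier.integrable_cexp_neg_mul_sq_norm_add (b := (c : ℂ)) (by simpa) 0
    (0 : EuclideanSpace ℝ (Fin m))).norm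
  refine h.congr (Filter.Eventually.of_forall fun θ => ?_)
  simp only [zero_mul, add_zero, Complex.norm_exp]
  congr 1
  rw [← ofReal_pow, ← ofReal_neg, ← ofReal_mul, ofReal_re]
  ring

theorem integral_gaussian_eq {c : ℝ} (hc : 0 < c) {t : ℝ} (ht : 0 < t) :
    ∫ θ : EuclideanSpace ℝ (Fin m), Real.exp (-(c * t * ‖θ‖ ^ 2)) =
      (Real.pi / c) ^ ((m : ℝ) / 2) * t ^ (-((m : ℝ) / 2)) := by
  have hpi := Real.pi_pos
  have h := GaussianFourier.integral_rexp_neg_mul_sq_norm (V := EuclideanSpace ℝ (Fin m))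
    (mul_pos hc ht)
  simp only [neg_mul] at h
  rw [h, finrank_euclideanSpace, Fintype.card_fin, Real.rpow_neg ht.le, ← Real.inv_rpow ht.le,
    ← Real.mul_rpow (by positivity) (by positivity)]
  congr 1
  field_simp

/-- The local limit theorem with a uniform rate. -/
theorem Equivariant.exists_law_sub_le (hΨ : A.Equivariant Ψ) (hh : A.HarmonicMap μ Ψ)
    (hgen : Subsemigroup.closure μ.toPMF.support = ⊤) (h1 : (1 : Γ) ∈ μ.S)
    {B : ℝ} (hB : ∀ x, ‖Ψ x - A.Φ x‖ ≤ B) :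
    ∃ C κ : ℝ, 0 < C ∧ 0 < κ ∧ ∀ n : ℕ, 1 ≤ n → ∀ x,
      |μ.law n x - κ * A.ξ ((n : ℝ) • A.covMatrix μ Ψ) x| ≤
        C / √n * (n : ℝ) ^ (-((m : ℝ) / 2)) := by
  have hM := hΨ.posDef_covMatrix hgen
  obtain ⟨L, N, hL, hN, hLN⟩ := exists_equiv_of_posDef hM
  obtain ⟨b, hb, hbΛ⟩ := A.exists_basis
  obtain ⟨c₁, hc₁, hc₁le⟩ := exists_mul_norm_sq_le L
  have hvar : ∀ θ, A.variance μ Ψ θ = ‖L θ‖ ^ 2 := fun θ => by rw [← hL, inner_covMatrix_self]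
  obtain ⟨C, c, hC, hc, hcc₁, hmain⟩ := hΨ.exists_norm_twist_pow_sub_le hh hgen h1 hb hc₁
    (fun θ => by rw [hvar]; exact hc₁le θ)
  obtain ⟨κ, hκ, hκint⟩ := exists_integral_dualCell b
  obtain ⟨κ', hκ', hgauss⟩ := exists_integral_gaussian_fourier hLN
  obtain ⟨κ'', hκ'', hξ⟩ := A.exists_ξ_smul_eq hM hN
  obtain ⟨δ, hδ, hδle⟩ := exists_le_norm_of_notMem_dualCell b
  obtain ⟨P, hP, hPle⟩ := exists_pow_mul_exp_neg_le 1 (show 0 < c₁ / 4 by positivity)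
  obtain ⟨KN, hKN, hKNle⟩ := N.toContinuousLinearMap.bound
  have hu := A.unif_pos
  have hpi := Real.pi_pos
  have hB0 : 0 ≤ B := (norm_nonneg _).trans (hB 1)
  set C' := C + A.unif * (P / δ) with hC'
  set I₀ := (Real.pi / c) ^ ((m : ℝ) / 2) with hI₀
  have hI₀pos : 0 < I₀ := by positivity
  -- The first summand is the Fourier error; the second pays for replacing $\Psi(x)-\Psi(1)$ by
  -- $\Phi(x)$ in the Gaussian.
  refine ⟨C' * I₀ / κ + A.unif * κ' / κ * (KN * (B + ‖Ψ 1‖)) , A.unif * κ' / (κ * κ''),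
    by positivity, by positivity, fun n hn x => ?_⟩
  have hn0 : (0 : ℝ) < n := by exact_mod_cast hn
  have hs : 0 < √(n : ℝ) := Real.sqrt_pos.2 hn0
  have hsq : √(n : ℝ) ^ 2 = n := Real.sq_sqrt hn0.le
  set y := Ψ x - Ψ 1 with hy
  set F := fun θ => cexp (-(I * (inner ℝ θ y : ℝ))) *
    (A.twist μ Ψ θ ^ n) (EuclideanSpace.single (A.coset x) 1) (A.coset 1) with hF
  set G := fun θ => cexp (-(I * (inner ℝ θ y : ℝ))) * (Real.exp (-(n * ‖L θ‖ ^ 2 / 2)) : ℝ) with hG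
  obtain ⟨hFint, hFeq⟩ := hΨ.integral_twist_pow (μ := μ) hbΛ hκint n x
  have hGeq := hgauss n hn0 y
  have hphase : ∀ θ, ‖cexp (-(I * (inner ℝ θ y : ℝ)))‖ = 1 := fun θ => by
    have := norm_cexp_I_mul (-(inner ℝ θ y : ℝ))
    rwa [ofReal_neg, mul_neg] at this
  have hGnorm : ∀ θ, ‖G θ‖ ≤ Real.exp (-(c₁ * n / 2 * ‖θ‖ ^ 2)) := fun θ => by
    rw [hG, norm_mul, hphase, one_mul, Complex.norm_real, Real.norm_of_nonneg (Real.exp_pos _).le]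
    refine Real.exp_le_exp.2 (neg_le_neg ?_)
    have := hc₁le θ
    calc _ = n * (c₁ * ‖θ‖ ^ 2) / 2 := by ring
      _ ≤ _ := by gcongr
  have hGint : Integrable G := by
    refine Integrable.mono' (integrable_gaussian (c := c₁ * n / 2) (by positivity)) ?_
      (Filter.Eventually.of_forall hGnorm)
    refine Continuous.aestronglyMeasurable ?_
    have hLc := L.continuous
    fun_prop
  have hFint' : Integrable ((dualCell b).indicator F) :=
    hFint.integrable_indicator (isClosed_dualCell b).measurableSet
  have hbound : ∀ θ, ‖(dualCell b).indicator F θ - A.unif * G θ‖ ≤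
      C' / √n * Real.exp (-(c * n * ‖θ‖ ^ 2)) := by
    intro θ
    by_cases hθ : θ ∈ dualCell b
    · rw [Set.indicator_of_mem hθ]
      have h2 := hmain n hn θ hθ (A.coset 1) (A.coset x)
      rw [hvar] at h2
      have e : F θ - A.unif * G θ = cexp (-(I * (inner ℝ θ y : ℝ))) *
          ((A.twist μ Ψ θ ^ n) (EuclideanSpace.single (A.coset x) 1) (A.coset 1) -
            ((A.unif * Real.exp (-(n * ‖L θ‖ ^ 2 / 2)) : ℝ) : ℂ)) := by
        rw [hF, hG]; push_cast; ring
      rw [e, norm_mul, hphase, one_mul]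
      refine h2.trans ?_
      gcongr
      rw [hC']
      have : 0 ≤ A.unif * (P / δ) := by positivity
      linarith
    · rw [Set.indicator_of_notMem hθ, zero_sub, norm_neg, norm_mul, Complex.norm_real,
        Real.norm_of_nonneg hu.le]
      have h2 := hδle θ hθ
      have h3 := hPle (√n * ‖θ‖) (by positivity)
      have h4 : Real.exp (-(c₁ * n / 2 * ‖θ‖ ^ 2)) =
          Real.exp (-(c₁ / 4 * (√n * ‖θ‖) ^ 2)) * Real.exp (-(c₁ / 4 * n * ‖θ‖ ^ 2)) := by
        rw [← Real.exp_add, mul_pow, hsq]; congr 1; ring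
      -- Outside the cell there is no twisted operator to compare with, but $|\theta|\ge\delta$
      -- makes half of the Gaussian itself $O(n^{-1/2})$.
      have h5 : Real.exp (-(c₁ / 4 * (√n * ‖θ‖) ^ 2)) ≤ P / δ / √n := by
        rw [div_div, le_div_iff₀ (by positivity)]
        refine le_trans ?_ h3
        calc _ ≤ Real.exp (-(c₁ / 4 * (√n * ‖θ‖) ^ 2)) * (‖θ‖ * √n) := by gcongr
          _ = _ := by ring
      calc _ ≤ A.unif * (Real.exp (-(c₁ / 4 * (√n * ‖θ‖) ^ 2)) *
            Real.exp (-(c₁ / 4 * n * ‖θ‖ ^ 2))) := by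
            rw [← h4]; gcongr; exact hGnorm θ
        _ ≤ A.unif * (P / δ / √n * Real.exp (-(c * n * ‖θ‖ ^ 2))) := by gcongr
        _ = A.unif * (P / δ) / √n * Real.exp (-(c * n * ‖θ‖ ^ 2)) := by ring
        _ ≤ _ := by
          gcongr
          rw [hC']; linarith
  have hint := norm_integral_le_of_norm_le
    ((integrable_gaussian (m := m) (c := c * n) (by positivity)).const_mul (C' / √n))
    (Filter.Eventually.of_forall hbound)
  rw [integral_sub hFint' (hGint.const_mul _), integral_indicator (isClosed_dualCell b).measurableSet,
    integral_const_mul, integral_const_mul, integral_gaussian_eq hc hn0] at hint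
  rw [hF, hFeq, hG, hGeq, ← ofReal_mul, ← ofReal_mul, ← ofReal_sub, Complex.norm_real,
    Real.norm_eq_abs] at hint
  rw [hξ n hn]
  set t := (n : ℝ) ^ (-((m : ℝ) / 2)) with ht
  have ht0 : 0 < t := by positivity
  have hexp : ∀ v, Real.exp (-(‖N v‖ ^ 2 / (2 * n))) = Real.exp (-((‖N v‖ / √n) ^ 2 / 2)) := by
    intro v; rw [div_pow, hsq]; congr 1; field_simp
  have hlip : |Real.exp (-(‖N y‖ ^ 2 / (2 * n))) - Real.exp (-(‖N (A.Φ x)‖ ^ 2 / (2 * n)))| ≤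
      KN * (B + ‖Ψ 1‖) / √n := by
    rw [hexp, hexp]
    refine (abs_exp_neg_sq_sub_le _ _).trans ?_
    rw [← sub_div, abs_div, abs_of_pos hs]
    gcongr
    refine (abs_norm_sub_norm_le _ _).trans ?_
    rw [← map_sub]
    refine (hKNle _).trans ?_
    gcongr
    have e : y - A.Φ x = (Ψ x - A.Φ x) - Ψ 1 := by rw [hy]; abel
    rw [e]
    refine (norm_sub_le _ _).trans ?_
    have := hB x
    gcongr
  have e : μ.law n x - A.unif * κ' / (κ * κ'') * (κ'' * t *
      Real.exp (-(‖N (A.Φ x)‖ ^ 2 / (2 * n)))) =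
      (κ * μ.law n x - A.unif * (κ' * t * Real.exp (-(‖N y‖ ^ 2 / (2 * n))))) / κ +
      A.unif * κ' / κ * t * (Real.exp (-(‖N y‖ ^ 2 / (2 * n))) -
        Real.exp (-(‖N (A.Φ x)‖ ^ 2 / (2 * n)))) := by
    field_simp
    ring
  rw [e]
  refine (abs_add_le _ _).trans ?_
  rw [abs_div, abs_of_pos hκ, abs_mul, abs_of_pos (show 0 < A.unif * κ' / κ * t by positivity)]
  calc _ ≤ C' / √n * (I₀ * t) / κ + A.unif * κ' / κ * t * (KN * (B + ‖Ψ 1‖) / √n) := by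
        gcongr
    _ = _ := by ring

/-- A Hoeffding bound: since the increments have mean zero, $e^z\le z+e^{z^2}$ shows that each step
multiplies the exponential moment by at most $e^{B^2|w|^2}$, where $B$ bounds the increments. -/
theorem Equivariant.exists_exp_moment_le (hΨ : A.Equivariant Ψ) (hh : A.HarmonicMap μ Ψ) :
    ∃ B : ℝ, 0 < B ∧ ∀ (w : EuclideanSpace ℝ (Fin m)) (n : ℕ),
      ∑ x ∈ (μ.law n).support, μ.law n x * Real.exp (inner ℝ w (Ψ x - Ψ 1)) ≤
        Real.exp (n * (B * ‖w‖ ^ 2)) := by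
  obtain ⟨B, hB, hBle⟩ := A.exists_norm_incr_le μ Ψ
  refine ⟨B ^ 2, by positivity, fun w n => ?_⟩
  have hlc : ∀ n, ∑ x ∈ (μ.law n).support, μ.law n x * Real.exp (inner ℝ w (Ψ x - Ψ 1)) =
      Finsupp.linearCombination ℝ (fun x => Real.exp (inner ℝ w (Ψ x - Ψ 1))) (μ.law n) := by
    intro n
    rw [Finsupp.linearCombination_apply, Finsupp.sum]
    rfl
  have hstep : ∀ x, ∑ s ∈ μ.S, μ.mass s • Real.exp (inner ℝ w (Ψ (x * s) - Ψ 1)) ≤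
      Real.exp (B ^ 2 * ‖w‖ ^ 2) * Real.exp (inner ℝ w (Ψ x - Ψ 1)) := by
    intro x
    set z : Γ → ℝ := fun s => inner ℝ w (A.incr Ψ (A.coset x) s) with hz
    have e : ∀ s, Real.exp (inner ℝ w (Ψ (x * s) - Ψ 1)) =
        Real.exp (inner ℝ w (Ψ x - Ψ 1)) * Real.exp (z s) := by
      intro s
      rw [hz, ← Real.exp_add, ← inner_add_right, hΨ.incr_coset]
      congr 2; abel
    have hz0 : ∑ s ∈ μ.S, μ.mass s * z s = 0 := by
      have h1 := congrArg (fun y => inner ℝ w y) (hh (A.coset x))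
      simpa only [inner_sum, inner_smul_right, inner_zero_right] using h1
    have h2 : ∑ s ∈ μ.S, μ.mass s * Real.exp (z s) ≤ Real.exp (B ^ 2 * ‖w‖ ^ 2) := by
      calc _ ≤ ∑ s ∈ μ.S, μ.mass s * (z s + Real.exp (B ^ 2 * ‖w‖ ^ 2)) := by
            refine Finset.sum_le_sum fun s hs => mul_le_mul_of_nonneg_left ?_ (μ.mass_nonneg s)
            refine (exp_le_add_exp_sq _).trans (add_le_add_right (Real.exp_le_exp.2 ?_) _)
            have h3 : |z s| ≤ B * ‖w‖ := (abs_real_inner_le_norm _ _).trans (by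
              rw [mul_comm]; gcongr; exact hBle _ s hs)
            rw [← sq_abs, ← mul_pow]
            gcongr
        _ = _ := by
          simp only [mul_add, Finset.sum_add_distrib]
          rw [hz0, ← Finset.sum_mul, μ.sum_mass]; ring
    simp_rw [e, smul_eq_mul, mul_left_comm (μ.mass _), ← Finset.mul_sum]
    rw [mul_comm]
    gcongr
  rw [hlc]
  induction n with
  | zero => simp [SymmetricLaw.law]
  | succ n ih =>
    rw [μ.linearCombination_law_succ]
    rw [← hlc] at ih
    calc _ = ∑ x ∈ (μ.law n).support, μ.law n x *
          ∑ s ∈ μ.S, μ.mass s • Real.exp (inner ℝ w (Ψ (x * s) - Ψ 1)) := by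
          rw [Finsupp.linearCombination_apply, Finsupp.sum]; rfl
      _ ≤ ∑ x ∈ (μ.law n).support, μ.law n x *
          (Real.exp (B ^ 2 * ‖w‖ ^ 2) * Real.exp (inner ℝ w (Ψ x - Ψ 1))) :=
        Finset.sum_le_sum fun x _ => mul_le_mul_of_nonneg_left (hstep x) (μ.law_nonneg n x)
      _ = Real.exp (B ^ 2 * ‖w‖ ^ 2) * ∑ x ∈ (μ.law n).support, μ.law n x *
          Real.exp (inner ℝ w (Ψ x - Ψ 1)) := by
        rw [Finset.mul_sum]; exact Finset.sum_congr rfl fun x _ => by ring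
      _ ≤ Real.exp (B ^ 2 * ‖w‖ ^ 2) * Real.exp (n * (B ^ 2 * ‖w‖ ^ 2)) := by gcongr
      _ = _ := by rw [← Real.exp_add]; congr 1; push_cast; ring

variable (A) in
/-- Gaussian sums over the orbit of the origin. -/
theorem exists_tsum_gaussian_le {a : ℝ} (ha : 0 < a) :
    ∃ C : ℝ, 0 < C ∧ ∀ t : ℝ, 1 ≤ t → Summable (fun x => Real.exp (-(a * ‖A.Φ x‖ ^ 2 / t))) ∧
      ∑' x, Real.exp (-(a * ‖A.Φ x‖ ^ 2 / t)) ≤ C * t ^ ((m : ℝ) / 2) := by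
  obtain ⟨r, hr, hdisj⟩ := A.exists_disjoint_ball
  have hpi := Real.pi_pos
  set V := (volume (Metric.ball (0 : EuclideanSpace ℝ (Fin m)) r)).toReal with hV
  have hVpos : 0 < V := ENNReal.toReal_pos (Metric.measure_ball_pos _ _ hr).ne'
    measure_ball_lt_top.ne
  refine ⟨Real.exp (a * r ^ 2) * (Real.pi / (a / 2)) ^ ((m : ℝ) / 2) / V, by positivity,
    fun t ht => ?_⟩
  have ht0 : 0 < t := by linarith
  set g : EuclideanSpace ℝ (Fin m) → ℝ := fun y => Real.exp (-(a / 2 * t⁻¹ * ‖y‖ ^ 2)) with hg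
  have hgint : Integrable g := integrable_gaussian (by positivity)
  -- On the ball about $\Phi(x)$, $|y|^2\le2(|\Phi(x)|^2+r^2)$, so halving the rate lets the
  -- Gaussian be compared with its integral; $t\ge1$ keeps the loss below $e^{ar^2}$.
  have hone : ∀ x, Real.exp (-(a * ‖A.Φ x‖ ^ 2 / t)) * V ≤
      Real.exp (a * r ^ 2) * ∫ y in Metric.ball (A.Φ x) r, g y := by
    intro x
    have h1 : Real.exp (-(a * ‖A.Φ x‖ ^ 2 / t)) * V =
        ∫ _y in Metric.ball (A.Φ x) r, Real.exp (-(a * ‖A.Φ x‖ ^ 2 / t)) := by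
      rw [setIntegral_const, smul_eq_mul, mul_comm, Measure.real,
        Measure.addHaar_ball_center]
    rw [h1, ← integral_const_mul]
    refine setIntegral_mono_on (integrableOn_const measure_ball_lt_top.ne)
      (hgint.integrableOn.const_mul _) measurableSet_ball fun y hy => ?_
    rw [hg, ← Real.exp_add]
    refine Real.exp_le_exp.2 ?_
    have h2 : ‖y‖ ≤ ‖A.Φ x‖ + r := by
      have h3 : ‖y - A.Φ x‖ < r := by rwa [← dist_eq_norm]
      calc ‖y‖ = ‖A.Φ x + (y - A.Φ x)‖ := by congr 1; abel
        _ ≤ _ := (norm_add_le _ _).trans (by gcongr)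
    have h4 : ‖y‖ ^ 2 ≤ 2 * (‖A.Φ x‖ ^ 2 + r ^ 2) :=
      (pow_le_pow_left₀ (norm_nonneg _) h2 2).trans add_sq_le
    have h5 : a / 2 * t⁻¹ * ‖y‖ ^ 2 ≤ a / 2 * t⁻¹ * (2 * (‖A.Φ x‖ ^ 2 + r ^ 2)) := by gcongr
    have h6 : a * r ^ 2 * t⁻¹ ≤ a * r ^ 2 :=
      mul_le_of_le_one_right (by positivity) (inv_le_one_of_one_le₀ ht)
    rw [div_eq_mul_inv]
    nlinarith
  have hfin : ∀ T : Finset Γ, ∑ x ∈ T, Real.exp (-(a * ‖A.Φ x‖ ^ 2 / t)) ≤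
      Real.exp (a * r ^ 2) * (Real.pi / (a / 2)) ^ ((m : ℝ) / 2) / V * t ^ ((m : ℝ) / 2) := by
    intro T
    have h1 : ∑ x ∈ T, ∫ y in Metric.ball (A.Φ x) r, g y ≤ ∫ y, g y := by
      rw [← integral_biUnion_finset T (fun x _ => measurableSet_ball)
        (fun x _ y _ hxy => hdisj x y hxy) (fun x _ => hgint.integrableOn)]
      exact setIntegral_le_integral hgint
        (Filter.Eventually.of_forall fun y => (Real.exp_pos _).le)
    have h2 : ∫ y, g y = (Real.pi / (a / 2)) ^ ((m : ℝ) / 2) * t ^ ((m : ℝ) / 2) := by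
      rw [hg, integral_gaussian_eq (half_pos ha) (inv_pos.2 ht0), Real.rpow_neg (by positivity),
        Real.inv_rpow ht0.le, inv_inv]
    have h3 : (∑ x ∈ T, Real.exp (-(a * ‖A.Φ x‖ ^ 2 / t))) * V ≤
        Real.exp (a * r ^ 2) * ∫ y, g y := by
      rw [Finset.sum_mul]
      refine (Finset.sum_le_sum fun x _ => hone x).trans ?_
      rw [← Finset.mul_sum]
      gcongr
    rw [h2, ← le_div_iff₀ hVpos] at h3
    refine h3.trans (le_of_eq ?_)
    ring
  exact ⟨summable_of_sum_le (fun x => (Real.exp_pos _).le) hfin,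
    Real.tsum_le_of_sum_le (fun x => (Real.exp_pos _).le) hfin⟩

end LatticeAction

/-! ### Tails and the total variation distance -/

/-- Comparison of a probability vector with the normalization of a positive function that is
proportional to it up to a small error. -/
theorem tvDist_div_tsum_le {ι : Type*} {p f : ι → ℝ} {κ ε : ℝ} (hp : HasSum p 1)
    (hf : Summable f) (hf0 : ∀ x, 0 ≤ f x) (hZ : 0 < ∑' x, f x)
    (h : ∑' x, |p x - κ * f x| ≤ ε) :
    tvDist p (fun x => f x / ∑' y, f y) ≤ ε := by
  set Z := ∑' y, f y with hZdef
  have hd : Summable fun x => p x - κ * f x := hp.summable.sub (hf.mul_left κ)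
  have h1 : |1 - κ * Z| ≤ ε := by
    rw [← hp.tsum_eq, hZdef, ← tsum_mul_left, ← hp.summable.tsum_sub (hf.mul_left κ)]
    exact (norm_tsum_le_tsum_norm hd.norm).trans h
  have h2 : ∀ x, |p x - f x / Z| ≤ |p x - κ * f x| + |κ - 1 / Z| * f x := by
    intro x
    have e : p x - f x / Z = (p x - κ * f x) + (κ - 1 / Z) * f x := by ring
    rw [e]
    refine (abs_add_le _ _).trans (le_of_eq ?_)
    rw [abs_mul, abs_of_nonneg (hf0 x)]
  have h3 : ∑' x, |p x - f x / Z| ≤ ε + |κ - 1 / Z| * Z := by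
    have hs : Summable fun x => |p x - κ * f x| + |κ - 1 / Z| * f x :=
      hd.abs.add (hf.mul_left _)
    refine ((hp.summable.sub (hf.div_const Z)).abs.tsum_le_tsum h2 hs).trans ?_
    rw [hd.abs.tsum_add (hf.mul_left _), tsum_mul_left]
    gcongr
  have h4 : |κ - 1 / Z| * Z = |1 - κ * Z| := by
    rw [← abs_of_pos hZ, ← abs_mul, abs_of_pos hZ, abs_sub_comm]
    congr 1
    field_simp
  -- The approximation error and the normalization error are each at most $\varepsilon$; the factor
  -- one half absorbs the two.
  unfold tvDist
  linarith

namespace LatticeAction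

variable {Γ : Type*} [Group Γ] {m : ℕ} {A : LatticeAction Γ m} {μ : SymmetricLaw Γ}
  {Ψ : Γ → EuclideanSpace ℝ (Fin m)}

/-- Otherwise $|y|^2\le m(R/(m+1))^2\le R^2$. Dividing by $m+1$ instead of $\sqrt m$ is wasteful but
also covers $m=0$. -/
theorem exists_le_abs_coord {y : EuclideanSpace ℝ (Fin m)} {R : ℝ}
    (hy : R ^ 2 < ‖y‖ ^ 2) : ∃ j, R / (m + 1) ≤ |y j| := by
  by_contra! hlt
  have h1 : ‖y‖ ^ 2 ≤ ∑ _j : Fin m, (R / (m + 1)) ^ 2 := by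
    rw [EuclideanSpace.norm_sq_eq]
    refine Finset.sum_le_sum fun j _ => ?_
    rw [Real.norm_eq_abs]
    exact pow_le_pow_left₀ (abs_nonneg _) (hlt j).le 2
  rw [Finset.sum_const, Finset.card_univ, Fintype.card_fin, nsmul_eq_mul] at h1
  have h2 : (m : ℝ) * (R / (m + 1)) ^ 2 ≤ R ^ 2 := by
    rw [div_pow, mul_div_assoc', div_le_iff₀ (by positivity), mul_comm]
    gcongr
    nlinarith [show (0 : ℝ) ≤ m by positivity]
  linarith

/-- The sum over the coordinate directions of the exponential weights of rate `t`. -/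
def expWeight (Ψ : Γ → EuclideanSpace ℝ (Fin m)) (t : ℝ) (x : Γ) : ℝ :=
  ∑ j : Fin m, (Real.exp (inner ℝ (EuclideanSpace.single j t) (Ψ x - Ψ 1)) +
    Real.exp (inner ℝ (EuclideanSpace.single j (-t)) (Ψ x - Ψ 1)))

theorem expWeight_nonneg (t : ℝ) (x : Γ) : 0 ≤ expWeight Ψ t x := by
  unfold expWeight; positivity

/-- The Chernoff weight: far from the origin some coordinate of $\Psi(x)-\Psi(1)$ is large, and both
of its signs occur in the sum. -/
theorem le_expWeight {B : ℝ} (hB : ∀ x, ‖Ψ x - A.Φ x‖ ≤ B) {t R : ℝ} (ht : 0 ≤ t)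
    {x : Γ} (hx : R ^ 2 < ‖A.Φ x‖ ^ 2) :
    Real.exp (t * (R / (m + 1) - (B + ‖Ψ 1‖))) ≤ expWeight Ψ t x := by
  obtain ⟨j, hj⟩ := exists_le_abs_coord hx
  set y := Ψ x - Ψ 1 with hy
  have h1 : |A.Φ x j| ≤ |y j| + (B + ‖Ψ 1‖) := by
    have e : A.Φ x j = y j + (Ψ 1 - (Ψ x - A.Φ x)) j := by
      simp [hy]
    rw [e]
    refine (abs_add_le _ _).trans ?_
    have h2 : |(Ψ 1 - (Ψ x - A.Φ x)) j| ≤ ‖Ψ 1 - (Ψ x - A.Φ x)‖ :=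
      PiLp.norm_apply_le (Ψ 1 - (Ψ x - A.Φ x)) j
    have h3 := (norm_sub_le (Ψ 1) (Ψ x - A.Φ x)).trans (add_le_add_right (hB x) _)
    linarith
  have h2 : R / (m + 1) - (B + ‖Ψ 1‖) ≤ |y j| := by linarith
  have hle : Real.exp (inner ℝ (EuclideanSpace.single j t) y) +
      Real.exp (inner ℝ (EuclideanSpace.single j (-t)) y) ≤ expWeight Ψ t x :=
    Finset.single_le_sum (f := fun j : Fin m => Real.exp (inner ℝ (EuclideanSpace.single j t) y) +
      Real.exp (inner ℝ (EuclideanSpace.single j (-t)) y)) (fun j _ => by positivity)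
      (Finset.mem_univ j)
  refine le_trans ?_ hle
  rw [EuclideanSpace.inner_single_left, EuclideanSpace.inner_single_left]
  simp only [conj_trivial]
  rcases abs_cases (y j) with ⟨ha, -⟩ | ⟨ha, -⟩
  · refine le_trans ?_ (le_add_of_nonneg_right (Real.exp_pos _).le)
    rw [ha] at h2
    gcongr
  · refine le_trans ?_ (le_add_of_nonneg_left (Real.exp_pos _).le)
    rw [ha] at h2
    rw [neg_mul, ← mul_neg]
    gcongr

theorem sum_law_mul_expWeight_le {B : ℝ} (hB : ∀ (w : EuclideanSpace ℝ (Fin m)) (n : ℕ),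
      ∑ x ∈ (μ.law n).support, μ.law n x * Real.exp (inner ℝ w (Ψ x - Ψ 1)) ≤
        Real.exp (n * (B * ‖w‖ ^ 2))) (t : ℝ) (n : ℕ) :
    ∑ x ∈ (μ.law n).support, μ.law n x * expWeight Ψ t x ≤
      2 * m * Real.exp (n * (B * t ^ 2)) := by
  simp only [expWeight, Finset.mul_sum]
  rw [Finset.sum_comm]
  calc _ ≤ ∑ _j : Fin m, 2 * Real.exp (n * (B * t ^ 2)) := by
        refine Finset.sum_le_sum fun j _ => ?_
        simp only [mul_add, Finset.sum_add_distrib]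
        have h1 := hB (EuclideanSpace.single j t) n
        have h2 := hB (EuclideanSpace.single j (-t)) n
        simp only [PiLp.norm_single, norm_neg, Real.norm_eq_abs, sq_abs] at h1 h2
        linarith
    _ = _ := by
      rw [Finset.sum_const, Finset.card_univ, Fintype.card_fin, nsmul_eq_mul]; ring

theorem hasSum_law (n : ℕ) : HasSum (fun x => (convPow μ.toPMF n x).toReal) 1 := by
  have h := (convPow μ.toPMF n).tsum_coe
  have h1 : Summable fun x => (convPow μ.toPMF n x).toReal :=
    ENNReal.summable_toReal (by rw [h]; exact ENNReal.one_ne_top)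
  have h2 := ENNReal.tsum_toReal_eq fun x => (convPow μ.toPMF n).apply_ne_top x
  rw [h, ENNReal.toReal_one] at h2
  exact h2 ▸ h1.hasSum

set_option maxHeartbeats 1000000 in
theorem Equivariant.exists_tsum_abs_law_sub_le (hΨ : A.Equivariant Ψ) (hh : A.HarmonicMap μ Ψ)
    (hgen : Subsemigroup.closure μ.toPMF.support = ⊤) (h1 : (1 : Γ) ∈ μ.S)
    {B : ℝ} (hB : ∀ x, ‖Ψ x - A.Φ x‖ ≤ B) :
    (∀ n : ℕ, 1 ≤ n → Summable (A.ξ ((n : ℝ) • A.covMatrix μ Ψ)) ∧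
      ∀ x, 0 < A.ξ ((n : ℝ) • A.covMatrix μ Ψ) x) ∧
    ∃ C κ : ℝ, 0 < C ∧ ∀ n : ℕ, 1 < n →
      ∑' x, |(convPow μ.toPMF n x).toReal - κ * A.ξ ((n : ℝ) • A.covMatrix μ Ψ) x| ≤
        C * Real.log n ^ ((m : ℝ) / 2) / √n := by
  have hM := hΨ.posDef_covMatrix hgen
  obtain ⟨L, N, -, hN, -⟩ := exists_equiv_of_posDef hM
  obtain ⟨κ', hκ', hξ⟩ := A.exists_ξ_smul_eq hM hN
  obtain ⟨c, hc, hcle⟩ := exists_mul_norm_sq_le N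
  -- The rate is chosen so that $\xi$ is bounded by two equal Gaussian factors: one becomes
  -- $n^{-1/2}$ outside the ball, the other stays summable.
  set a := c / 4 with ha
  have hapos : 0 < a := by positivity
  have hξle : ∀ n : ℕ, 1 ≤ n → ∀ x, A.ξ ((n : ℝ) • A.covMatrix μ Ψ) x ≤
      κ' * (n : ℝ) ^ (-((m : ℝ) / 2)) * (Real.exp (-(a * ‖A.Φ x‖ ^ 2 / n)) *
        Real.exp (-(a * ‖A.Φ x‖ ^ 2 / n))) := by
    intro n hn x
    have hn0 : (0 : ℝ) < n := by exact_mod_cast hn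
    rw [hξ n hn, ← Real.exp_add]
    gcongr
    have := hcle (A.Φ x)
    calc _ = -((c * ‖A.Φ x‖ ^ 2) / (2 * n)) := by rw [ha]; field_simp; ring
      _ ≥ _ := by gcongr
  obtain ⟨G₁, hG₁, hgauss₁⟩ := A.exists_tsum_gaussian_le one_pos
  obtain ⟨Ga, hGa, hgaussa⟩ := A.exists_tsum_gaussian_le hapos
  refine ⟨fun n hn => ⟨?_, fun x => ?_⟩, ?_⟩
  · have hn1 : (1 : ℝ) ≤ n := by exact_mod_cast hn
    refine Summable.of_nonneg_of_le (fun x => ?_) (fun x => (hξle n hn x).trans ?_)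
      ((hgaussa n hn1).1.mul_left (κ' * (n : ℝ) ^ (-((m : ℝ) / 2))))
    · rw [hξ n hn]; positivity
    · gcongr
      refine mul_le_of_le_one_right (Real.exp_pos _).le (Real.exp_le_one_iff.2 ?_)
      have : 0 ≤ a * ‖A.Φ x‖ ^ 2 / n := by positivity
      linarith
  · have hn0 : (0 : ℝ) < n := by exact_mod_cast hn
    rw [hξ n hn]; positivity
  obtain ⟨C, κ, hC, hκ, hloc⟩ := hΨ.exists_law_sub_le hh hgen h1 hB
  obtain ⟨D, hD, hmom⟩ := hΨ.exists_exp_moment_le hh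
  have hB0 : 0 ≤ B := (norm_nonneg _).trans (hB 1)
  -- The summands serve the tail of the walk (`hkD`), the tail of the Gaussian (`hka`), and $k\ge1$.
  set k := (m + 1) * (D + 1 / 2) + 1 / (2 * a) + 1 with hk
  have hk1 : 1 ≤ k := le_add_of_nonneg_left (by positivity)
  have hka : 1 / 2 ≤ a * k ^ 2 := by
    have h2 : 1 / (2 * a) ≤ k := by
      have : 0 ≤ (m + 1) * (D + 1 / 2) := by positivity
      linarith
    rw [div_le_iff₀ (by positivity)] at h2
    nlinarith
  have hkD : D + 1 / 2 ≤ k / (m + 1) := by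
    rw [le_div_iff₀ (by positivity)]
    have : 0 ≤ 1 / (2 * a) := by positivity
    linarith
  set b := B + ‖Ψ 1‖ with hb
  have hb0 : 0 ≤ b := by positivity
  set E₁ := C * Real.exp 1 * G₁ * (k ^ 2) ^ ((m : ℝ) / 2) with hE₁
  set E₂ := κ * κ' * Ga + 2 * m * Real.exp b with hE₂
  have hlog2 : 0 < Real.log 2 := Real.log_pos one_lt_two
  -- The tails carry no logarithm; as $\log n\ge\log2$, dividing by a power of $\log 2$ absorbs them
  -- into the main term.
  refine ⟨E₁ + E₂ / Real.log 2 ^ ((m : ℝ) / 2), κ, by positivity, fun n hn => ?_⟩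
  have hn1 : 1 ≤ n := hn.le
  have hn2 : (2 : ℝ) ≤ n := by exact_mod_cast hn
  have hn0 : (0 : ℝ) < n := by linarith
  have hnr1 : (1 : ℝ) ≤ n := by linarith
  have hs : 0 < √(n : ℝ) := Real.sqrt_pos.2 hn0
  set ℓ := Real.log n with hℓ
  have hℓ2 : Real.log 2 ≤ ℓ := Real.log_le_log two_pos hn2
  have hℓ0 : 0 < ℓ := by linarith
  have hℓn : ℓ ≤ n := (Real.log_le_sub_one_of_pos hn0).trans (by linarith)
  have hexpℓ : Real.exp (-(ℓ / 2)) = 1 / √n := by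
    rw [Real.exp_neg, Real.exp_half, hℓ, Real.exp_log hn0, one_div]
  set R := k * √(n * ℓ) with hR
  have hR0 : 0 < R := by positivity
  have hRsq : R ^ 2 = k ^ 2 * (n * ℓ) := by rw [hR, mul_pow, Real.sq_sqrt (by positivity)]
  have hR1 : 1 ≤ R ^ 2 := by
    rw [hRsq]
    have h2 : 1 ≤ n * ℓ := by
      have h3 : 2 * Real.log 2 ≤ n * ℓ := by gcongr
      linarith [Real.log_two_gt_d9]
    exact one_le_mul_of_one_le_of_one_le (one_le_pow₀ hk1) h2
  -- With this rate $nDt^2=D\ell$ and $tR=k\ell$, so the Chernoff exponent is a multiple of $\log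
  -- n$.
  set t := √(ℓ / n) with ht
  have ht0 : 0 ≤ t := Real.sqrt_nonneg _
  have htsq : t ^ 2 = ℓ / n := Real.sq_sqrt (by positivity)
  have ht1 : t ≤ 1 := by
    rw [ht, Real.sqrt_le_left zero_le_one, one_pow]
    exact div_le_one_of_le₀ hℓn hn0.le
  have htR : t * R = k * ℓ := by
    rw [ht, hR, mul_left_comm, ← Real.sqrt_mul (by positivity)]
    have : ℓ / n * (n * ℓ) = ℓ ^ 2 := by field_simp
    rw [this, Real.sqrt_sq hℓ0.le]
  set u := (n : ℝ) ^ (-((m : ℝ) / 2)) with hu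
  have hu0 : 0 < u := by positivity
  have huinv : u * (n : ℝ) ^ ((m : ℝ) / 2) = 1 := by
    rw [hu, ← Real.rpow_add hn0]; simp
  set W := Real.exp (-(t * (R / (m + 1) - b))) with hW
  -- Three majorants: `α` carries the uniform local error on the ball, with the indicator replaced
  -- by $e$ times a Gaussian of width $R$ so that the points are counted by a Gaussian sum; `β` and
  -- `ω` cover the tails of the Gaussian and of the walk.
  set α : Γ → ℝ := fun x =>
    C / √n * u * Real.exp 1 * Real.exp (-(1 * ‖A.Φ x‖ ^ 2 / R ^ 2)) with hα
  set β : Γ → ℝ := fun x => κ * κ' * u / √n * Real.exp (-(a * ‖A.Φ x‖ ^ 2 / n)) with hβ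
  set ω : Γ → ℝ := fun x => W * (μ.law n x * expWeight Ψ t x) with hω
  have hωnn : ∀ x, 0 ≤ ω x := fun x =>
    mul_nonneg (Real.exp_pos _).le (mul_nonneg (μ.law_nonneg n x) (expWeight_nonneg t x))
  have hpt : ∀ x, |(convPow μ.toPMF n x).toReal - κ * A.ξ ((n : ℝ) • A.covMatrix μ Ψ) x| ≤
      α x + β x + ω x := by
    intro x
    rw [μ.toReal_convPow]
    have hβnn : 0 ≤ β x := by positivity
    have hαnn : 0 ≤ α x := by positivity
    rcases le_or_gt (‖A.Φ x‖ ^ 2) (R ^ 2) with hx | hx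
    · have h2 : C / √n * u ≤ α x := by
        rw [hα]
        simp only
        rw [mul_assoc (C / √n * u), ← Real.exp_add]
        refine le_mul_of_one_le_right (by positivity) (Real.one_le_exp ?_)
        have : 1 * ‖A.Φ x‖ ^ 2 / R ^ 2 ≤ 1 := by
          rw [one_mul]; exact div_le_one_of_le₀ hx (by positivity)
        linarith
      have := hωnn x
      have := hloc n hn1 x
      linarith
    · have h2 : μ.law n x ≤ ω x := by
        have h3 := le_expWeight hB ht0 hx
        calc μ.law n x = W * (μ.law n x * Real.exp (t * (R / (m + 1) - b))) := by
              rw [hW, mul_left_comm, ← Real.exp_add]; simp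
          _ ≤ _ := mul_le_mul_of_nonneg_left
            (mul_le_mul_of_nonneg_left h3 (μ.law_nonneg n x)) (Real.exp_pos _).le
      have h4 : κ * A.ξ ((n : ℝ) • A.covMatrix μ Ψ) x ≤ β x := by
        have h5 : Real.exp (-(a * ‖A.Φ x‖ ^ 2 / n)) ≤ 1 / √n := by
          rw [← hexpℓ]
          refine Real.exp_le_exp.2 (neg_le_neg ?_)
          rw [le_div_iff₀ hn0]
          rw [hRsq] at hx
          have h6 : 1 / 2 * (n * ℓ) ≤ a * k ^ 2 * (n * ℓ) := by gcongr
          have h7 : a * (k ^ 2 * (n * ℓ)) ≤ a * ‖A.Φ x‖ ^ 2 := by gcongr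
          linarith
        calc _ ≤ κ * (κ' * u * (Real.exp (-(a * ‖A.Φ x‖ ^ 2 / n)) * (1 / √n))) := by
              refine mul_le_mul_of_nonneg_left ((hξle n hn1 x).trans ?_) hκ.le
              gcongr
          _ = _ := by rw [hβ]; ring
      have h6 : 0 ≤ κ * A.ξ ((n : ℝ) • A.covMatrix μ Ψ) x := by
        rw [hξ n hn1]; positivity
      have := μ.law_nonneg n x
      rw [abs_le]
      constructor <;> linarith
  obtain ⟨hs₁, hle₁⟩ := hgauss₁ (R ^ 2) hR1
  obtain ⟨hsa, hlea⟩ := hgaussa n hnr1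
  have hαs : Summable α := hs₁.mul_left _
  have hβs : Summable β := hsa.mul_left _
  have hω0 : ∀ x ∉ (μ.law n).support, ω x = 0 := fun x hx => by
    rw [hω]; simp [Finsupp.notMem_support_iff.1 hx]
  have hωs : Summable ω := summable_of_ne_finset_zero hω0
  have hαle : ∑' x, α x ≤ E₁ * ℓ ^ ((m : ℝ) / 2) / √n := by
    rw [hα, tsum_mul_left]
    have h2 : (R ^ 2) ^ ((m : ℝ) / 2) =
        (k ^ 2) ^ ((m : ℝ) / 2) * ((n : ℝ) ^ ((m : ℝ) / 2) * ℓ ^ ((m : ℝ) / 2)) := by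
      rw [hRsq, Real.mul_rpow (by positivity) (by positivity), Real.mul_rpow hn0.le hℓ0.le]
    calc _ ≤ C / √n * u * Real.exp 1 * (G₁ * (R ^ 2) ^ ((m : ℝ) / 2)) := by gcongr
      _ = (u * (n : ℝ) ^ ((m : ℝ) / 2)) * (E₁ * ℓ ^ ((m : ℝ) / 2) / √n) := by
        rw [h2, hE₁]; ring
      _ = _ := by rw [huinv, one_mul]
  have hβle : ∑' x, β x ≤ κ * κ' * Ga / √n := by
    rw [hβ, tsum_mul_left]
    calc _ ≤ κ * κ' * u / √n * (Ga * (n : ℝ) ^ ((m : ℝ) / 2)) := by gcongr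
      _ = (u * (n : ℝ) ^ ((m : ℝ) / 2)) * (κ * κ' * Ga / √n) := by ring
      _ = _ := by rw [huinv, one_mul]
  have hωle : ∑' x, ω x ≤ 2 * m * Real.exp b / √n := by
    rw [tsum_eq_sum hω0, hω, ← Finset.mul_sum]
    calc _ ≤ W * (2 * m * Real.exp (n * (D * t ^ 2))) := by
          gcongr; exact sum_law_mul_expWeight_le hmom t n
      _ = 2 * m * Real.exp (n * (D * t ^ 2) - t * (R / (m + 1) - b)) := by
        rw [hW, Real.exp_sub, Real.exp_neg]; ring
      _ ≤ 2 * m * Real.exp (b + -(ℓ / 2)) := by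
        gcongr
        have e1 : n * (D * t ^ 2) = D * ℓ := by rw [htsq]; field_simp
        have e2 : t * (R / (m + 1) - b) = k / (m + 1) * ℓ - t * b := by
          rw [mul_sub, mul_div_assoc', htR]; ring
        rw [e1, e2]
        have h2 : (D + 1 / 2) * ℓ ≤ k / (m + 1) * ℓ := by gcongr
        have h3 : t * b ≤ b := mul_le_of_le_one_left hb0 ht1
        linarith
      _ = _ := by rw [Real.exp_add, hexpℓ]; ring
  have hdsum : ∑' x, |(convPow μ.toPMF n x).toReal - κ * A.ξ ((n : ℝ) • A.covMatrix μ Ψ) x| ≤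
      ∑' x, (α x + β x + ω x) :=
    (Summable.of_nonneg_of_le (fun x => abs_nonneg _) hpt
      ((hαs.add hβs).add hωs)).tsum_le_tsum hpt ((hαs.add hβs).add hωs)
  refine hdsum.trans ?_
  rw [(hαs.add hβs).tsum_add hωs, hαs.tsum_add hβs]
  have hlogpow : Real.log 2 ^ ((m : ℝ) / 2) ≤ ℓ ^ ((m : ℝ) / 2) := by gcongr
  have hE₂le : E₂ ≤ E₂ / Real.log 2 ^ ((m : ℝ) / 2) * ℓ ^ ((m : ℝ) / 2) := by
    rw [div_mul_eq_mul_div, le_div_iff₀ (by positivity)]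
    gcongr
  calc _ ≤ E₁ * ℓ ^ ((m : ℝ) / 2) / √n + κ * κ' * Ga / √n + 2 * m * Real.exp b / √n := by
        gcongr
    _ = (E₁ * ℓ ^ ((m : ℝ) / 2) + E₂) / √n := by rw [hE₂]; ring
    _ ≤ (E₁ * ℓ ^ ((m : ℝ) / 2) + E₂ / Real.log 2 ^ ((m : ℝ) / 2) * ℓ ^ ((m : ℝ) / 2)) / √n := by
      gcongr
    _ = _ := by ring

end LatticeAction

end

end LatticeWalk

theorem theorem3p7 {Γ : Type*} [Group Γ] {m : ℕ} (A : LatticeWalk.LatticeAction Γ m)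
    (μ : LatticeWalk.SymmetricLaw Γ)
    (hgen : Subsemigroup.closure μ.toPMF.support = ⊤)
    (hid : 0 < μ.toPMF 1) :
    ∃ M : Matrix (Fin m) (Fin m) ℝ,
      M.PosDef ∧
      A.IsCovariance μ M ∧
      -- the discrete normal distribution is a well-defined probability distribution
      (∀ n : ℕ, 1 ≤ n → HasSum (A.discreteNormal ((n : ℝ) • M)) 1) ∧
      ∃ C : ℝ, 0 < C ∧ ∀ n : ℕ, 1 < n →
        LatticeWalk.tvDist (fun x => (LatticeWalk.convPow μ.toPMF n x).toReal)
            (A.discreteNormal ((n : ℝ) • M)) ≤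
          C * (Real.log n) ^ ((m : ℝ) / 2) / √(n : ℝ) := by
  have h1 : (1 : Γ) ∈ μ.S := by
    rw [LatticeWalk.SymmetricLaw.mem_S, PMF.mem_support_iff]
    exact hid.ne'
  obtain ⟨Ψ, hΨ, hh, hcov, B, -, hB⟩ := A.exists_harmonicMap μ
  obtain ⟨hξ, C, κ, hC, hle⟩ := hΨ.exists_tsum_abs_law_sub_le hh hgen h1 hB
  have hZ : ∀ n : ℕ, 1 ≤ n → 0 < ∑' x, A.ξ ((n : ℝ) • A.covMatrix μ Ψ) x := fun n hn =>
    (hξ n hn).1.tsum_pos (fun x => ((hξ n hn).2 x).le) 1 ((hξ n hn).2 1)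
  refine ⟨A.covMatrix μ Ψ, hΨ.posDef_covMatrix hgen, hcov, fun n hn => ?_, C, hC, fun n hn => ?_⟩
  · have := (hξ n hn).1.hasSum.div_const (∑' x, A.ξ ((n : ℝ) • A.covMatrix μ Ψ) x)
    rwa [div_self (hZ n hn).ne'] at this
  · exact LatticeWalk.tvDist_div_tsum_le (LatticeWalk.LatticeAction.hasSum_law n) (hξ n hn.le).1
      (fun x => ((hξ n hn.le).2 x).le) (hZ n hn.le) (hle n hn)
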